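/- Let $\mathcal G$ be a connected metric graph with finitely many vertices and finitely many edges (loops and multiple edges allowed). Each edge $e$ is identified with an interval $I_e$, which is either bounded, $I_e=[0,\ell_e]$ with $\ell_e>0$ and both endpoints attached to vertices, or infinite, $I_e=[0,\infty)$ with $0$ attached to a vertex. Let $H^1(\mathcal G)$ be the set of functions $u=(u_e)_e:\mathcal G\to\mathbb C$ that are continuous on $\mathcal G$ and satisfy $\sum_e\int_{I_e}(|u_e|^2+|u_e'|^2)\,dx<\infty$, with $u_e'$ the weak derivative, and for $\mu>0$ let $H^1_\mu(\mathcal G)=\{u\in H^1(\mathcal G):\|u\|_{L^2(\mathcal G)}^2=\mu\}$. Let $A=(A_e)_e$ be a real magnetic potential with $A\in L^2_{\rm loc}(\mathcal G)$. A cycle is a nonempty closed walk along bounded edges that repeats no edge. For a cycle $\gamma$ let $|\gamma|$ be the sum of the lengths of its edges, let $\int_\gamma A\,dx$ be the line integral of $A$ along $\gamma$ (edges traversed against their orientation count with a minus sign), and put $$\Phi_\gamma(A)=\frac{4\pi^2}{|\gamma|^2}\,\mathrm{dist}\Big(\frac{1}{2\pi}\int_\gamma A\,dx,\ \mathbb Z\Big)^2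 .$$ Let $C(\mathcal G)$ be a set of $\beta_{\mathcal G}$ independent cycles of $\mathcal G$ (cycles whose integral $1$-chains are linearly independent), where $\beta_{\mathcal G}$ is the first Betti number of $\mathcal G$, that is, the number of bounded edges minus the number of vertices plus one. For $u\in H^1(\mathcal G)$ define $$I_A(u,\mathcal G)=\frac12\int_{\mathcal G}|u'|^2\,dx+\sum_{\gamma\in C(\mathcal G)}\int_\gamma\Phi_\gamma(A)\,|u|^2\,dx-\frac1p\int_{\mathcal G}|u|^p\,dx .$$ For $2<p<6$ and $\mu>0$ let $\phi_\mu(x)=\mu^{\alpha}C_p\,\mathrm{sech}^{\alpha/\beta}(c_p\mu^{\beta}x)$, with $\alpha=\frac{2}{6-p}$ and $\beta=\frac{p-2}{6-p}$, be the soliton of mass $\mu$ on $\mathbb R$. Here $c_p=\frac{p-2}{2}\sqrt{\omega_p}$ and $C_p=\big(\frac{p\,\omega_p}{2}\big)^{1/(p-2)}$, where $$\omega_p=\bigg(\frac{p-2}{2\,(p/2)^{2/(p-2)}\int_{\mathbb R}\mathrm{sech}^{4/(p-2)}(y)\,dy}\bigg)^{2\beta}$$ (so that $\|\phi_\mu\|_{L^2(\mathbb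 R)}^2=\mu$ and $-\phi_\mu''+\omega_p\mu^{2\beta}\phi_\mu=\phi_\mu^{p-1}$), and let $E(\phi_\mu,\mathbb R)=\frac12\int_{\mathbb R}|\phi_\mu'|^2\,dx-\frac1p\int_{\mathbb R}|\phi_\mu|^p\,dx$. **Theorem.** Let $2<p<6$ and $\mu>0$, and suppose that $\mathcal G$ has at least one infinite edge. If there is a function $v\in H^1_\mu(\mathcal G)$ with $$I_A(v,\mathcal G)<E(\phi_\mu,\mathbb R),$$ then $I_A(\cdot,\mathcal G)$ has a ground state of mass $\mu$: there is $u\in H^1_\mu(\mathcal G)$ such that $I_A(u,\mathcal G)\le I_A(w,\mathcal G)$ for every $w\in H^1_\mu(\mathcal G)$. -/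

import Mathlib

open MeasureTheory

noncomputable section

/-- A metric graph with vertices `V`, bounded edges `E` (loops and multiple edges allowed) and
infinite edges `H`. The bounded edge `e` is the interval `[0, len e]`, with `0` glued to the vertex
`src e` and `len e` glued to `tgt e`; the infinite edge `h` is the half-line `[0, ∞)`, with `0`
glued to `root h`. -/
structure MetricGraph (V E H : Type*) where
  src : E → V
  tgt : E → V
  len : E → ℝ
  len_pos : ∀ e, 0 < len e
  root : H → V

namespace MetricGraph

variable {V E H : Type*} (G : MetricGraph V E H)

/-- The coordinate interval `I_e` of an edge. -/
def interval : E ⊕ H → Set ℝ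
  | Sum.inl e => Set.Icc 0 (G.len e)
  | Sum.inr _ => Set.Ici 0

/-! ### Walks, connectedness and cycles -/

/-- Initial vertex of a bounded edge traversed forwards (`true`) or backwards (`false`). -/
def stepStart : E × Bool → V
  | (e, true) => G.src e
  | (e, false) => G.tgt e

/-- Final vertex of a bounded edge traversed forwards (`true`) or backwards (`false`). -/
def stepEnd : E × Bool → V
  | (e, true) => G.tgt e
  | (e, false) => G.src e

/-- `G.IsWalk v l w`: the oriented edges in `l` form, in this order, a walk from `v` to `w`. -/
def IsWalk : V → List (E × Bool) → V → Prop
  | v, [], w => v = w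
  | v, s :: l, w => G.stepStart s = v ∧ IsWalk (G.stepEnd s) l w

/-- Any two vertices are joined by a walk (the half-lines are attached to vertices, so this is
connectedness of the whole metric graph). -/
def Connected : Prop := ∀ v w : V, ∃ l, G.IsWalk v l w

/-- The sign of an oriented edge: `1` if it is traversed forwards, `-1` if backwards. -/
def stepSign (s : E × Bool) : ℤ := if s.2 then 1 else -1

/-- A cycle: a nonempty closed walk that repeats no edge (such a walk has a nonzero chain, so it
is never contractible to a point). -/
structure Cycle where
  base : V
  steps : List (E × Bool)
  steps_ne_nil : steps ≠ []
  isWalk : G.IsWalk base steps base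
  nodup : (steps.map Prod.fst).Nodup

/-- The cyclomatic number `|E| - |V| + 1` of a connected graph. Half-lines do not contribute: each
of them adds one edge and one vertex at infinity. -/
def cyclomaticNumber (_ : MetricGraph V E H) [Fintype V] [Fintype E] : ℕ := Fintype.card E + 1 - Fintype.card V

variable {G}

namespace Cycle

/-- The integral 1-chain of a cycle: the signed sum of its edges. -/
def chain (γ : G.Cycle) : E →₀ ℤ := (γ.steps.map fun s => Finsupp.single s.1 (stepSign s)).sum

/-- The length `|γ|`. -/
def length (γ : G.Cycle) : ℝ := (γ.steps.map fun s => G.len s.1).sum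

/-- The magnetic flux `∫_γ A dx`; an edge traversed backwards contributes with a minus sign. -/
def flux (γ : G.Cycle) (A : E ⊕ H → ℝ → ℝ) : ℝ :=
  (γ.steps.map fun s => (stepSign s : ℝ) * ∫ x in (0 : ℝ)..G.len s.1, A (Sum.inl s.1) x).sum

/-- The effective potential `Φ_γ(A) = (4π² / |γ|²) dist(∫_γ A dx / 2π, ℤ)²`. -/
def potential (γ : G.Cycle) (A : E ⊕ H → ℝ → ℝ) : ℝ :=
  4 * Real.pi ^ 2 / γ.length ^ 2 *
    Metric.infDist (γ.flux A / (2 * Real.pi)) (Set.range ((↑) : ℤ → ℝ)) ^ 2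

end Cycle

variable (G)

/-- A full set of independent cycles of a connected graph: as many cycles as the cyclomatic
number, with linearly independent chains. -/
structure IndependentCycles [Fintype V] [Fintype E] where
  cycle : Fin G.cyclomaticNumber → G.Cycle
  indep : LinearIndependent ℤ fun i => (cycle i).chain

/-! ### The space `H¹(G)` -/

/-- An element of `H¹(G)`: complex functions `u_e` on the edges, together with their weak
derivatives `u'_e`, both square integrable, such that each `u_e` is the absolutely continuous
primitive of `u'_e` and `u` is continuous at the vertices. Only the values on the coordinate
intervals matter. -/
structure H1 where
  toFun : E ⊕ H → ℝ → ℂ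
  der : E ⊕ H → ℝ → ℂ
  memLp_toFun : ∀ e, MemLp (toFun e) 2 (volume.restrict (G.interval e))
  memLp_der : ∀ e, MemLp (der e) 2 (volume.restrict (G.interval e))
  eq_add_integral : ∀ e, ∀ x ∈ G.interval e, toFun e x = toFun e 0 + ∫ t in (0 : ℝ)..x, der e t
  continuous_vertex : ∃ c : V → ℂ,
    (∀ e, toFun (Sum.inl e) 0 = c (G.src e) ∧ toFun (Sum.inl e) (G.len e) = c (G.tgt e)) ∧
    (∀ h, toFun (Sum.inr h) 0 = c (G.root h))

/-- `A ∈ L²_loc(G)`. -/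
def IsL2Loc (A : E ⊕ H → ℝ → ℝ) : Prop :=
  ∀ e, ∀ K ⊆ G.interval e, IsCompact K → MemLp (A e) 2 (volume.restrict K)

variable {G} [Fintype V] [Fintype E] [Fintype H]

/-- The mass `‖u‖₂²`. -/
def mass (u : G.H1) : ℝ := ∑ e, ∫ x in G.interval e, ‖u.toFun e x‖ ^ 2

/-- The NLS energy `E(u, G) = ½ ‖u'‖₂² - (1/p) ‖u‖_p^p`. -/
def nlsEnergy (p : ℝ) (u : G.H1) : ℝ :=
  (1 / 2) * (∑ e, ∫ x in G.interval e, ‖u.der e x‖ ^ 2)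
    - (1 / p) * (∑ e, ∫ x in G.interval e, ‖u.toFun e x‖ ^ p)

/-- The effective functional
`I_A(u, G) = ½ ∫_G |u'|² + ∑_{γ ∈ C(G)} ∫_γ Φ_γ(A) |u|² - (1/p) ∫_G |u|^p`. -/
def effectiveEnergy (p : ℝ) (A : E ⊕ H → ℝ → ℝ) (C : G.IndependentCycles) (u : G.H1) : ℝ :=
  nlsEnergy p u + ∑ i : Fin G.cyclomaticNumber, ((C.cycle i).steps.map fun s =>
    ∫ x in G.interval (Sum.inl s.1), (C.cycle i).potential A * ‖u.toFun (Sum.inl s.1) x‖ ^ 2).sum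

/-- `u` is a ground state of `I_A(·, G)` at mass `μ`: it has mass `μ` and minimizes `I_A(·, G)`
among all functions in `H¹(G)` of mass `μ`. -/
def IsGroundState (p : ℝ) (A : E ⊕ H → ℝ → ℝ) (C : G.IndependentCycles) (μ : ℝ) (u : G.H1) :
    Prop :=
  mass u = μ ∧ ∀ w : G.H1, mass w = μ → effectiveEnergy p A C u ≤ effectiveEnergy p A C w

end MetricGraph

/-! ### The soliton on the line -/

namespace Soliton

/-- The exponent `α = 2 / (6 - p)`. -/
def expα (p : ℝ) : ℝ := 2 / (6 - p)

/-- The exponent `β = (p - 2) / (6 - p)`. -/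
def expβ (p : ℝ) : ℝ := (p - 2) / (6 - p)

/-- The frequency `ω` of the soliton of mass `1`: the positive `ω` for which the solution
`(pω/2)^(1/(p-2)) sech^(2/(p-2)) (((p-2)/2) √ω x)` of `-φ'' + ωφ = φ^(p-1)` has mass `1`. -/
def unitFreq (p : ℝ) : ℝ :=
  ((p - 2) / (2 * (p / 2) ^ (2 / (p - 2)) * (∫ y : ℝ, (Real.cosh y)⁻¹ ^ (4 / (p - 2)))))
    ^ (2 * expβ p)

/-- The constant `C_p`. -/
def ampl (p : ℝ) : ℝ := (p * unitFreq p / 2) ^ (1 / (p - 2))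

/-- The constant `c_p`. -/
def rate (p : ℝ) : ℝ := (p - 2) / 2 * Real.sqrt (unitFreq p)

/-- The soliton `φ_μ(x) = μ^α C_p sech^(α/β) (c_p μ^β x)` of mass `μ`. -/
def soliton (p μ x : ℝ) : ℝ :=
  μ ^ expα p * ampl p * (Real.cosh (rate p * μ ^ expβ p * x))⁻¹ ^ (expα p / expβ p)

/-- The NLS energy on the line, `E(u, ℝ) = ½ ∫ |u'|² - (1/p) ∫ |u|^p`. -/
def lineEnergy (p : ℝ) (u : ℝ → ℝ) : ℝ :=
  (1 / 2) * (∫ x, |deriv u x| ^ 2) - (1 / p) * ∫ x, |u x| ^ p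

end Soliton

end

/-! Let `J` be the infimum of the energy at mass `μ`. The uniform bound `exists_norm_sq_le` together
with `p < 6` makes the energy coercive (`exists_kinetic_le`), so a minimizing sequence has a
subsequence converging pointwise, with weakly convergent derivatives, to some `u`
(`exists_H1_limit`). On truncated edges nothing is lost in the limit, and the magnetic term lives on
bounded edges only; mass can escape only along the half-lines.

Escaping mass `m = μ - mass u` carries at least the energy `-binding p m` of the soliton of mass
`m`, so `J ≥ I_A(u) - binding p m` (`effectiveEnergy_sub_binding_le`). This rests on a phase-plane
estimate on a half-line (`neg_binding_sub_le_halfLine`). If `M` is the supremum of `n = |v|` there,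
Young's inequality bounds `½ n'² + (1/p)(M^(p-2) n² - n^p)` below by `|(Ψ ∘ n)'|` for a suitable
increasing `Ψ`. Climbing from the cut to `M` and descending to `0` gives `2 Ψ(M)`, up to a boundary
term at the cut. Minimizing over `M` produces exactly the soliton energy (`neg_binding_le`). Several
half-lines are no better than one, because `binding` is superadditive (`sum_binding_le`).

Put `θ = m / μ`. Scaling `u` up to mass `μ` gives `I_A(u) ≥ (1 - θ) J` (`mul_le_effectiveEnergy`),
and `binding p m ≤ θ * binding p μ` (`binding_le_of_le`). Hence `J ≥ (1 - θ) J - θ * binding p μ`.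
If `θ > 0`, this forces `J ≥ -binding p μ`, which is the energy of `φ_μ` (`lineEnergy_soliton`),
against the assumption on `v`. So no mass is lost and `u` is a minimizer. -/

noncomputable section

namespace Soliton

open Real Set Filter Topology

/-! ### Powers of the hyperbolic secant -/

lemma inv_cosh_pos (y : ℝ) : 0 < (cosh y)⁻¹ := inv_pos.2 (cosh_pos y)

lemma inv_cosh_le_exp (y : ℝ) : (cosh y)⁻¹ ≤ 2 * exp (-|y|) := by
  rw [← cosh_abs, exp_neg, cosh_eq, inv_eq_one_div, div_le_iff₀ (by positivity)]
  have h := exp_pos |y|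
  have : 2 * (exp |y|)⁻¹ * ((exp |y| + exp (-|y|)) / 2) = 1 + (exp |y|)⁻¹ * exp (-|y|) := by
    field_simp
  rw [this]
  have : 0 ≤ (exp |y|)⁻¹ * exp (-|y|) := by positivity
  linarith

lemma continuous_sech_rpow (a : ℝ) : Continuous fun y : ℝ => (cosh y)⁻¹ ^ a :=
  (continuous_cosh.inv₀ fun y => (cosh_pos y).ne').rpow_const
    fun y => Or.inl (inv_cosh_pos y).ne'

lemma integrable_exp_neg_mul_abs {a : ℝ} (ha : 0 < a) : Integrable fun y : ℝ => exp (-a * |y|) := by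
  -- A non-integrable function has integral `0` by convention, so computing a nonzero integral
  -- proves integrability.
  apply Integrable.of_integral_ne_zero
  rw [integral_comp_abs (f := fun y => exp (-a * y)), integral_exp_mul_Ioi (by linarith) 0]
  simp [ha.ne']

lemma sech_rpow_le_exp {a : ℝ} (ha : 0 < a) (y : ℝ) :
    (cosh y)⁻¹ ^ a ≤ 2 ^ a * exp (-a * |y|) := by
  calc (cosh y)⁻¹ ^ a ≤ (2 * exp (-|y|)) ^ a :=
        rpow_le_rpow (inv_cosh_pos y).le (inv_cosh_le_exp y) ha.le
    _ = 2 ^ a * exp (-a * |y|) := by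
        rw [mul_rpow (by norm_num) (exp_pos _).le, ← exp_mul]; congr 2; ring

lemma integrable_sech_rpow {a : ℝ} (ha : 0 < a) : Integrable fun y : ℝ => (cosh y)⁻¹ ^ a := by
  refine ((integrable_exp_neg_mul_abs ha).const_mul (2 ^ a)).mono'
    (continuous_sech_rpow a).aestronglyMeasurable (Eventually.of_forall fun y => ?_)
  rw [norm_of_nonneg (rpow_nonneg (inv_cosh_pos y).le _)]
  exact sech_rpow_le_exp ha y

lemma tendsto_sech_rpow {a : ℝ} (ha : 0 < a) {l : Filter ℝ}
    (hl : Tendsto (fun y : ℝ => |y|) l atTop) :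
    Tendsto (fun y : ℝ => (cosh y)⁻¹ ^ a) l (𝓝 0) := by
  refine squeeze_zero (fun y => rpow_nonneg (inv_cosh_pos y).le _) (sech_rpow_le_exp ha) ?_
  have : Tendsto (fun y : ℝ => exp (-(a * |y|))) l (𝓝 0) :=
    tendsto_exp_neg_atTop_nhds_zero.comp (hl.const_mul_atTop ha)
  simpa using this.const_mul (2 ^ a)

lemma sinh_div_cosh_sq (y : ℝ) : (sinh y / cosh y) ^ 2 = 1 - (cosh y)⁻¹ ^ (2 : ℝ) := by
  have h := cosh_pos y
  rw [rpow_two, div_pow, sinh_sq]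
  field_simp

lemma abs_sinh_div_cosh_le_one (y : ℝ) : |sinh y / cosh y| ≤ 1 := by
  rw [← sq_le_one_iff_abs_le_one, sinh_div_cosh_sq]
  have := rpow_nonneg (inv_cosh_pos y).le 2
  linarith

lemma continuous_sinh_div_cosh : Continuous fun y : ℝ => sinh y / cosh y :=
  continuous_sinh.div₀ continuous_cosh fun y => (cosh_pos y).ne'

lemma hasDerivAt_sech_rpow (a y : ℝ) :
    HasDerivAt (fun y : ℝ => (cosh y)⁻¹ ^ a) (-a * (cosh y)⁻¹ ^ a * (sinh y / cosh y)) y := by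
  have h := cosh_pos y
  have h1 := ((hasDerivAt_cosh y).inv h.ne').rpow_const (p := a) (Or.inl (inv_cosh_pos y).ne')
  refine h1.congr_deriv ?_
  have h2 : (cosh⁻¹ y) = (cosh y)⁻¹ := rfl
  rw [h2, rpow_sub_one (inv_cosh_pos y).ne']
  field_simp

lemma hasDerivAt_sinh_div_cosh (y : ℝ) :
    HasDerivAt (fun y : ℝ => sinh y / cosh y) ((cosh y)⁻¹ ^ (2 : ℝ)) y := by
  have h := cosh_pos y
  refine ((hasDerivAt_sinh y).div (hasDerivAt_cosh y) h.ne').congr_deriv ?_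
  rw [rpow_two]
  field_simp
  linarith [cosh_sq y]

lemma integrable_sech_rpow_mul_tanh_sq {a : ℝ} (ha : 0 < a) :
    Integrable fun y : ℝ => (cosh y)⁻¹ ^ a * (sinh y / cosh y) ^ 2 := by
  refine (integrable_sech_rpow ha).mono'
    ((continuous_sech_rpow a).mul (continuous_sinh_div_cosh.pow 2)).aestronglyMeasurable
    (Eventually.of_forall fun y => ?_)
  have h0 := rpow_nonneg (inv_cosh_pos y).le a
  rw [norm_of_nonneg (by positivity)]
  exact mul_le_of_le_one_right h0 ((sq_le_one_iff_abs_le_one _).2 (abs_sinh_div_cosh_le_one y))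

/-- Integration by parts for powers of the hyperbolic secant. -/
lemma integral_sech_rpow_mul_tanh_sq {a : ℝ} (ha : 0 < a) :
    (a + 1) * ∫ y : ℝ, (cosh y)⁻¹ ^ a * (sinh y / cosh y) ^ 2 = ∫ y : ℝ, (cosh y)⁻¹ ^ a := by
  have hlim : ∀ {l : Filter ℝ}, Tendsto (fun y : ℝ => |y|) l atTop →
      Tendsto (fun y : ℝ => (cosh y)⁻¹ ^ a * (sinh y / cosh y)) l (𝓝 0) := fun hl => by
    refine squeeze_zero_norm (fun y => ?_) (tendsto_sech_rpow ha hl)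
    have h0 := rpow_nonneg (inv_cosh_pos y).le a
    rw [norm_mul, norm_of_nonneg h0]
    exact mul_le_of_le_one_right h0 (abs_sinh_div_cosh_le_one y)
  -- The product rule gives `sech^(a+2) - a sech^a tanh²`; then `sech² = 1 - tanh²`.
  have hd : ∀ y : ℝ, HasDerivAt (fun y : ℝ => (cosh y)⁻¹ ^ a * (sinh y / cosh y))
      ((cosh y)⁻¹ ^ a - (a + 1) * ((cosh y)⁻¹ ^ a * (sinh y / cosh y) ^ 2)) y := fun y => by
    refine ((hasDerivAt_sech_rpow a y).mul (hasDerivAt_sinh_div_cosh y)).congr_deriv ?_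
    have := sinh_div_cosh_sq y
    linear_combination (cosh y)⁻¹ ^ a * this
  have hi := (integrable_sech_rpow_mul_tanh_sq ha).const_mul (a + 1)
  have := integral_of_hasDerivAt_of_tendsto hd ((integrable_sech_rpow ha).sub hi)
    (hlim tendsto_abs_atBot_atTop) (hlim tendsto_abs_atTop_atTop)
  rw [integral_sub (integrable_sech_rpow ha) hi, integral_const_mul] at this
  linarith

lemma integral_sech_rpow_add_two {a : ℝ} (ha : 0 < a) :
    (a + 1) * ∫ y : ℝ, (cosh y)⁻¹ ^ (a + 2) = a * ∫ y : ℝ, (cosh y)⁻¹ ^ a := by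
  have h : ∀ y : ℝ, (cosh y)⁻¹ ^ (a + 2)
      = (cosh y)⁻¹ ^ a - (cosh y)⁻¹ ^ a * (sinh y / cosh y) ^ 2 := fun y => by
    rw [rpow_add (inv_cosh_pos y), sinh_div_cosh_sq]; ring
  simp_rw [h]
  rw [integral_sub (integrable_sech_rpow ha) (integrable_sech_rpow_mul_tanh_sq ha)]
  linarith [integral_sech_rpow_mul_tanh_sq ha]

lemma integral_sech_rpow_pos {a : ℝ} (ha : 0 < a) : 0 < ∫ y : ℝ, (cosh y)⁻¹ ^ a := by
  rw [integral_pos_iff_support_of_nonneg (fun y => rpow_nonneg (inv_cosh_pos y).le _)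
    (integrable_sech_rpow ha)]
  have : Function.support (fun y : ℝ => (cosh y)⁻¹ ^ a) = univ :=
    eq_univ_of_forall fun y => (rpow_pos_of_pos (inv_cosh_pos y) _).ne'
  simp [this]

/-! ### The phase-plane profile -/

/-- The profile `√(t² - t^p)` of the homoclinic orbit of the normalised soliton equation. -/
def orbit (p t : ℝ) : ℝ := √(t ^ 2 - t ^ p)

/-- The primitive of `orbit p` vanishing at `0`. -/
def orbitArea (p t : ℝ) : ℝ := ∫ s in (0 : ℝ)..t, orbit p s

lemma continuous_orbit {p : ℝ} (hp : 0 < p) : Continuous (orbit p) :=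
  ((continuous_id.pow 2).sub (continuous_rpow_const hp.le)).sqrt

lemma orbit_nonneg (p t : ℝ) : 0 ≤ orbit p t := sqrt_nonneg _

lemma orbit_sq {p t : ℝ} (hp : 2 < p) (h0 : 0 ≤ t) (h1 : t ≤ 1) :
    orbit p t ^ 2 = t ^ 2 - t ^ p := by
  refine sq_sqrt (sub_nonneg.2 ?_)
  rcases h0.eq_or_lt with rfl | h0
  · rw [zero_rpow (by linarith)]; norm_num
  · rw [← rpow_two]; exact rpow_le_rpow_of_exponent_ge h0 h1 hp.le

lemma orbit_le {p t : ℝ} (h0 : 0 ≤ t) : orbit p t ≤ t := by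
  rw [orbit, sqrt_le_left h0]
  linarith [rpow_nonneg h0 p]

lemma hasDerivAt_orbitArea {p : ℝ} (hp : 0 < p) (t : ℝ) :
    HasDerivAt (orbitArea p) (orbit p t) t :=
  intervalIntegral.integral_hasDerivAt_right ((continuous_orbit hp).intervalIntegrable _ _)
    (continuous_orbit hp).aestronglyMeasurable.stronglyMeasurableAtFilter
    (continuous_orbit hp).continuousAt

lemma orbitArea_zero (p : ℝ) : orbitArea p 0 = 0 := by simp [orbitArea]

lemma orbitArea_le {p t : ℝ} (hp : 0 < p) (h0 : 0 ≤ t) : orbitArea p t ≤ t ^ 2 / 2 := by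
  calc orbitArea p t ≤ ∫ s in (0 : ℝ)..t, s :=
        intervalIntegral.integral_mono_on h0 ((continuous_orbit hp).intervalIntegrable _ _)
          (continuous_id.intervalIntegrable _ _) fun s hs => orbit_le hs.1
    _ = t ^ 2 / 2 := by simp

/-- Substitute `s = sech^q y` with `q = 2/(p-2)`. Then `s^(p-2) = sech² y`, so the orbit becomes `s
tanh y` for `y ≥ 0`, and the area is `q` times the integral of `sech^(2q) tanh²` over `(0, ∞)`.
Evenness and integration by parts finish, since `2q + 1 = (p+2)/(p-2)`. -/
lemma orbitArea_one {p : ℝ} (hp : 2 < p) :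
    orbitArea p 1 = (∫ y : ℝ, (cosh y)⁻¹ ^ (4 / (p - 2))) / (p + 2) := by
  have hp2 : 0 < p - 2 := by linarith
  have hp0 : 0 < p := by linarith
  set q : ℝ := 2 / (p - 2) with hq
  have hq0 : 0 < q := by positivity
  have hq2 : 4 / (p - 2) = 2 * q := by rw [hq]; ring
  have hqp : q * p = 2 * q + 2 := by rw [hq]; field_simp; ring
  have hd : ∀ y ∈ Ici (0 : ℝ), HasDerivAt (fun y : ℝ => orbitArea p ((cosh y)⁻¹ ^ q))
      (-q * ((cosh y)⁻¹ ^ (2 * q) * (sinh y / cosh y) ^ 2)) y := fun y hy => by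
    refine ((hasDerivAt_orbitArea hp0 _).comp y (hasDerivAt_sech_rpow q y)).congr_deriv ?_
    have hc := inv_cosh_pos y
    have h1 : ((cosh y)⁻¹ ^ q) ^ 2 = (cosh y)⁻¹ ^ (2 * q) := by
      rw [← rpow_two, ← rpow_mul hc.le, mul_comm]
    have ht : 0 ≤ sinh y / cosh y := div_nonneg (sinh_nonneg_iff.2 hy) (cosh_pos y).le
    have h2 : orbit p ((cosh y)⁻¹ ^ q) = (cosh y)⁻¹ ^ q * (sinh y / cosh y) := by
      rw [orbit, ← rpow_mul hc.le, hqp, rpow_add hc, h1.symm,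
        show ((cosh y)⁻¹ ^ q) ^ 2 - ((cosh y)⁻¹ ^ q) ^ 2 * (cosh y)⁻¹ ^ (2 : ℝ)
          = ((cosh y)⁻¹ ^ q * (sinh y / cosh y)) ^ 2 by rw [mul_pow, sinh_div_cosh_sq]; ring]
      exact sqrt_sq (mul_nonneg (rpow_nonneg hc.le _) ht)
    rw [h2, ← h1]; ring
  have hlim : Tendsto (fun y : ℝ => orbitArea p ((cosh y)⁻¹ ^ q)) atTop (𝓝 0) := by
    have h := (hasDerivAt_orbitArea hp0 0).continuousAt.tendsto.comp
      (tendsto_sech_rpow hq0 tendsto_abs_atTop_atTop)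
    rwa [orbitArea_zero] at h
  have hint := integrable_sech_rpow_mul_tanh_sq (a := 2 * q) (by positivity)
  have h1 := integral_Ioi_of_hasDerivAt_of_tendsto' hd (hint.const_mul (-q)).integrableOn hlim
  have h2 := integral_comp_abs (f := fun y : ℝ => (cosh y)⁻¹ ^ (2 * q) * (sinh y / cosh y) ^ 2)
  have h3 : ∀ y : ℝ, (cosh |y|)⁻¹ ^ (2 * q) * (sinh |y| / cosh |y|) ^ 2
      = (cosh y)⁻¹ ^ (2 * q) * (sinh y / cosh y) ^ 2 := fun y => by
    rw [sinh_div_cosh_sq, sinh_div_cosh_sq, cosh_abs]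
  simp_rw [h3] at h2
  have h4 := integral_sech_rpow_mul_tanh_sq (a := 2 * q) (by positivity)
  rw [integral_const_mul, cosh_zero, inv_one, one_rpow, zero_sub] at h1
  rw [hq2, ← h4, eq_div_iff (by positivity)]
  have h5 : orbitArea p 1
      = q * (∫ y : ℝ, (cosh y)⁻¹ ^ (2 * q) * (sinh y / cosh y) ^ 2) / 2 := by
    rw [h2]; linarith
  rw [h5, hq]
  field_simp
  ring

/-! ### The energy of the soliton -/

/-- Minus the energy of the soliton of mass `m` on the line. -/
def binding (p m : ℝ) : ℝ := unitFreq p * (6 - p) / (2 * (p + 2)) * m ^ ((p + 2) / (6 - p))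

lemma unitFreq_pos {p : ℝ} (hp : 2 < p) : 0 < unitFreq p := by
  have h : 0 < p - 2 := by linarith
  have := integral_sech_rpow_pos (a := 4 / (p - 2)) (by positivity)
  unfold unitFreq
  have : 0 < p := by linarith
  positivity

lemma binding_nonneg {p m : ℝ} (hp2 : 2 < p) (hp6 : p < 6) (hm : 0 ≤ m) : 0 ≤ binding p m := by
  have h1 := unitFreq_pos hp2
  have h2 : 0 < 6 - p := by linarith
  have h3 : 0 < p + 2 := by linarith
  unfold binding
  positivity

lemma binding_zero {p : ℝ} (hp2 : 2 < p) (hp6 : p < 6) : binding p 0 = 0 := by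
  have h2 : 0 < 6 - p := by linarith
  have h3 : 0 < p + 2 := by linarith
  rw [binding, zero_rpow (by positivity), mul_zero]

lemma continuous_binding {p : ℝ} (hp2 : 2 < p) (hp6 : p < 6) : Continuous (binding p) := by
  have h2 : 0 < 6 - p := by linarith
  have h3 : 0 < p + 2 := by linarith
  exact continuous_const.mul (continuous_rpow_const (by positivity))

/-- The binding energy grows at least linearly. -/
lemma binding_le_of_le {p m M : ℝ} (hp2 : 2 < p) (hp6 : p < 6) (hm : 0 ≤ m) (hmM : m ≤ M)
    (hM : 0 < M) : binding p m ≤ m / M * binding p M := by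
  have h1 := unitFreq_pos hp2
  have h2 : 0 < 6 - p := by linarith
  have h3 : 0 < p + 2 := by linarith
  -- This is where `p ≥ 2` enters: the exponent of the mass is at least one.
  have hs : 1 ≤ (p + 2) / (6 - p) := by rw [le_div_iff₀ h2]; linarith
  have h : (m / M) ^ ((p + 2) / (6 - p)) ≤ m / M := by
    rcases hm.eq_or_lt with rfl | hm
    · rw [zero_div, zero_rpow (by positivity)]
    · simpa using rpow_le_rpow_of_exponent_ge (div_pos hm hM) ((div_le_one hM).2 hmM) hs
  have h4 : m ^ ((p + 2) / (6 - p)) = (m / M) ^ ((p + 2) / (6 - p)) * M ^ ((p + 2) / (6 - p)) := by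
    rw [← mul_rpow (by positivity) hM.le, div_mul_cancel₀ _ hM.ne']
  unfold binding
  rw [h4]
  calc _ = (m / M) ^ ((p + 2) / (6 - p)) * (unitFreq p * (6 - p) / (2 * (p + 2))
        * M ^ ((p + 2) / (6 - p))) := by ring
    _ ≤ _ := mul_le_mul_of_nonneg_right h (by positivity)

/-- The binding energy is superadditive. -/
lemma sum_binding_le {ι : Type*} (S : Finset ι) {p : ℝ} (hp2 : 2 < p) (hp6 : p < 6) {m : ι → ℝ}
    (hm : ∀ i, 0 ≤ m i) : ∑ i ∈ S, binding p (m i) ≤ binding p (∑ i ∈ S, m i) := by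
  rcases (Finset.sum_nonneg fun i (_ : i ∈ S) => hm i).eq_or_lt with h | h
  · have h0 := (Finset.sum_eq_zero_iff_of_nonneg fun i _ => hm i).1 h.symm
    rw [Finset.sum_eq_zero fun i hi => by rw [h0 i hi, binding_zero hp2 hp6]]
    exact binding_nonneg hp2 hp6 h.le
  · calc ∑ i ∈ S, binding p (m i)
        ≤ ∑ i ∈ S, m i / (∑ j ∈ S, m j) * binding p (∑ j ∈ S, m j) :=
          Finset.sum_le_sum fun i hi => binding_le_of_le hp2 hp6 (hm i)
            (Finset.single_le_sum (fun j _ => hm j) hi) h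
      _ = binding p (∑ j ∈ S, m j) := by
          rw [← Finset.sum_mul, ← Finset.sum_div, div_self h.ne', one_mul]

/-- The maximum of the soliton of mass `m`. -/
def peak (p m : ℝ) : ℝ := m ^ expα p * ampl p

lemma peak_pos {p m : ℝ} (hp : 2 < p) (hm : 0 < m) : 0 < peak p m := by
  have := unitFreq_pos hp
  have : 0 < p := by linarith
  unfold peak ampl
  positivity

lemma peak_rpow {p m : ℝ} (hp2 : 2 < p) (hp6 : p < 6) (hm : 0 < m) :
    peak p m ^ (p - 2) = p * (unitFreq p * m ^ (2 * expβ p)) / 2 := by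
  have h1 := unitFreq_pos hp2
  have h0 : 0 < p := by linarith
  have h2 : 0 < 6 - p := by linarith
  have h3 : 0 < p - 2 := by linarith
  rw [peak, ampl, mul_rpow (by positivity) (by positivity), ← rpow_mul hm.le,
    ← rpow_mul (by positivity), one_div_mul_cancel h3.ne', rpow_one,
    show expα p * (p - 2) = 2 * expβ p by unfold expα expβ; ring]
  ring

/-- The `L²` norm of the soliton, in terms of its maximum. -/
lemma peak_sq_mul_integral {p m : ℝ} (hp2 : 2 < p) (hp6 : p < 6) (hm : 0 < m) :
    peak p m ^ 2 * ∫ y : ℝ, (cosh y)⁻¹ ^ (4 / (p - 2)) = m * (rate p * m ^ expβ p) := by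
  have h1 := unitFreq_pos hp2
  have h0 : 0 < p := by linarith
  have h2 : 0 < 6 - p := by linarith
  have h3 : 0 < p - 2 := by linarith
  have hJ := integral_sech_rpow_pos (a := 4 / (p - 2)) (by positivity)
  set J := ∫ y : ℝ, (cosh y)⁻¹ ^ (4 / (p - 2)) with hJdef
  set X : ℝ := (p - 2) / (2 * (p / 2) ^ (2 / (p - 2)) * J) with hX
  have hX0 : 0 < X := by positivity
  have hω : unitFreq p = X ^ (2 * expβ p) := rfl
  -- The exponents in `e1` and `e2` match because `2α = 1 + β` and `4β/(p-2) = 1 + β`.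
  have e1 : peak p m ^ 2 = m ^ (1 : ℝ) * m ^ expβ p * ((p / 2) ^ (2 / (p - 2)) *
      unitFreq p ^ (2 / (p - 2))) := by
    rw [← mul_rpow (by positivity) h1.le, ← rpow_add hm, peak, ampl, mul_pow, ← rpow_two,
      ← rpow_mul hm.le, ← rpow_two, ← rpow_mul (by positivity)]
    congr 2
    · unfold expα expβ; field_simp; ring
    · ring
    · ring
  have e2 : unitFreq p ^ (2 / (p - 2)) = X * √(unitFreq p) := by
    rw [sqrt_eq_rpow, hω, ← rpow_mul hX0.le, ← rpow_mul hX0.le]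
    nth_rewrite 2 [← rpow_one X]
    rw [← rpow_add hX0]
    congr 1
    unfold expβ; field_simp; ring
  rw [e1, e2, rpow_one, rate, hX]
  field_simp

/-- After rescaling by `k`, the integrals of `sech^(2q) tanh²` and `sech^(2q+2)` are multiples of
that of `sech^(2q)`, which is fixed by the mass. Kinetic and potential parts become `m w /
(2(2q+1))` and `m w q / (2q+1)`. -/
lemma lineEnergy_soliton {p m : ℝ} (hp2 : 2 < p) (hp6 : p < 6) (hm : 0 < m) :
    lineEnergy p (soliton p m) = -binding p m := by
  have h1 := unitFreq_pos hp2
  have h0 : 0 < p := by linarith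
  have h2 : 0 < 6 - p := by linarith
  have h3 : 0 < p - 2 := by linarith
  have hJ := integral_sech_rpow_pos (a := 4 / (p - 2)) (by positivity)
  have hmass := peak_sq_mul_integral hp2 hp6 hm
  have hpeak := peak_rpow hp2 hp6 hm
  have hB := peak_pos hp2 hm
  set q : ℝ := 2 / (p - 2) with hq
  have hq0 : 0 < q := by positivity
  have hq2 : 4 / (p - 2) = 2 * q := by rw [hq]; ring
  have hqp : q * p = 2 * q + 2 := by rw [hq]; field_simp; ring
  have hqe : expα p / expβ p = q := by unfold expα expβ; rw [hq]; field_simp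
  rw [hq2] at hJ hmass
  set B := peak p m with hBdef
  set k := rate p * m ^ expβ p with hk
  set w := unitFreq p * m ^ (2 * expβ p) with hw
  have hk0 : 0 < k := by unfold k rate; positivity
  have hkw : k ^ 2 * q ^ 2 = w := by
    rw [hk, hw, hq, rate, mul_pow, mul_pow, sq_sqrt h1.le, ← rpow_two (m ^ _), ← rpow_mul hm.le,
      mul_comm (expβ p)]
    field_simp
  have hsol : soliton p m = fun x => B * (cosh (k * x))⁻¹ ^ q := by
    ext x; rw [soliton, hqe, hBdef, peak]
  have hder : ∀ x, |deriv (soliton p m) x| ^ 2 = B ^ 2 * w *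
      ((cosh (k * x))⁻¹ ^ (2 * q) * (sinh (k * x) / cosh (k * x)) ^ 2) := fun x => by
    have hd : HasDerivAt (soliton p m)
        (B * (-q * (cosh (k * x))⁻¹ ^ q * (sinh (k * x) / cosh (k * x)) * (k * 1))) x := by
      rw [hsol]
      exact ((hasDerivAt_sech_rpow q (k * x)).comp x ((hasDerivAt_id x).const_mul k)).const_mul B
    rw [hd.deriv, sq_abs, ← hkw, mul_comm 2 q, rpow_mul (inv_cosh_pos _).le, rpow_two]
    ring
  have hpow : ∀ x, |soliton p m x| ^ p = B ^ 2 * (p * w / 2) * (cosh (k * x))⁻¹ ^ (2 * q + 2) :=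
    fun x => by
      have hc := (inv_cosh_pos (k * x)).le
      rw [hsol]
      simp only
      rw [abs_of_nonneg (by positivity), mul_rpow hB.le (by positivity), ← rpow_mul hc, hqp,
        ← hpeak, ← rpow_two, ← rpow_add hB, add_sub_cancel]
  simp_rw [lineEnergy, hder, hpow]
  rw [integral_const_mul, integral_const_mul,
    Measure.integral_comp_mul_left
      (fun y : ℝ => (cosh y)⁻¹ ^ (2 * q) * (sinh y / cosh y) ^ 2) k,
    Measure.integral_comp_mul_left (fun y : ℝ => (cosh y)⁻¹ ^ (2 * q + 2)) k,
    abs_of_pos (inv_pos.2 hk0), smul_eq_mul, smul_eq_mul]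
  have i1 := integral_sech_rpow_mul_tanh_sq (a := 2 * q) (by positivity)
  have i2 := integral_sech_rpow_add_two (a := 2 * q) (by positivity)
  have hbind : binding p m = w * (6 - p) / (2 * (p + 2)) * m := by
    rw [binding, hw, show (p + 2) / (6 - p) = 2 * expβ p + 1 by unfold expβ; field_simp; ring,
      rpow_add hm, rpow_one]
    ring
  rw [hbind]
  set J := ∫ y : ℝ, (cosh y)⁻¹ ^ (2 * q)
  set T := ∫ y : ℝ, (cosh y)⁻¹ ^ (2 * q) * (sinh y / cosh y) ^ 2
  set Z := ∫ y : ℝ, (cosh y)⁻¹ ^ (2 * q + 2)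
  have hq1 : 2 * q + 1 ≠ 0 := by positivity
  have hT : T = J / (2 * q + 1) := by rw [eq_div_iff hq1]; linarith
  have hZ : Z = 2 * q * J / (2 * q + 1) := by rw [eq_div_iff hq1]; linarith
  have hJ' : B ^ 2 * (k⁻¹ * J) = m := by field_simp; linarith
  have e : 1 / 2 * (B ^ 2 * w * (k⁻¹ * T)) - 1 / p * (B ^ 2 * (p * w / 2) * (k⁻¹ * Z))
      = (B ^ 2 * (k⁻¹ * J)) * w * (1 / 2 - q) / (2 * q + 1) := by
    rw [hT, hZ]; field_simp
  rw [e, hJ', hq]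
  field_simp
  ring

/-- The minimum over all heights `M` of the phase-plane lower bound for the energy is the energy
of the soliton. -/
lemma neg_binding_le {p m M : ℝ} (hp2 : 2 < p) (hp6 : p < 6) (hm : 0 ≤ m) (hM : 0 ≤ M) :
    -binding p m ≤
      2 * √(2 / p) * orbitArea p 1 * M ^ (p / 2 + 1) - m / p * M ^ (p - 2) := by
  have h0 : 0 < p := by linarith
  have h2 : 0 < 6 - p := by linarith
  have h3 : 0 < p - 2 := by linarith
  have hJ := integral_sech_rpow_pos (a := 4 / (p - 2)) (by positivity)
  rcases hm.eq_or_lt with rfl | hm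
  · rw [binding_zero hp2 hp6, orbitArea_one hp2]
    have : 0 ≤ M ^ (p / 2 + 1) := by positivity
    rw [zero_div, zero_mul, sub_zero, neg_zero]
    positivity
  have h1 := unitFreq_pos hp2
  have hmass := peak_sq_mul_integral hp2 hp6 hm
  have hpeak := peak_rpow hp2 hp6 hm
  have hB := peak_pos hp2 hm
  rw [orbitArea_one hp2]
  set J := ∫ y : ℝ, (cosh y)⁻¹ ^ (4 / (p - 2))
  set B := peak p m
  set w := unitFreq p * m ^ (2 * expβ p) with hw
  have hw0 : 0 < w := by positivity
  have hk : rate p * m ^ expβ p = (p - 2) / 2 * √w := by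
    rw [rate, hw, sqrt_mul h1.le, sqrt_eq_rpow (m ^ _), ← rpow_mul hm.le]
    rw [show 2 * expβ p * (1 / 2) = expβ p by ring]; ring
  rw [hk] at hmass
  -- Heights are measured relative to the soliton's peak `B`, so the minimum is expected at `t = 1`.
  obtain ⟨t, ht, rfl⟩ : ∃ t, 0 ≤ t ∧ M = t * B := ⟨M / B, by positivity, by field_simp⟩
  have hbind : binding p m = w * (6 - p) / (2 * (p + 2)) * m := by
    rw [binding, hw, show (p + 2) / (6 - p) = 2 * expβ p + 1 by unfold expβ; field_simp; ring,
      rpow_add hm, rpow_one]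
    ring
  -- `r` is the quotient of the two exponents `p - 2` and `p/2 + 1`; in `Y = t^(p/2+1)` the bound
  -- becomes `(m w / 2)(r Y - Y^r)`.
  set r := 2 * (p - 2) / (p + 2) with hr
  have hr1 : r ≤ 1 := by rw [hr, div_le_one (by linarith)]; linarith
  have hY0 : 0 ≤ t ^ (p / 2 + 1) := by positivity
  have hY : t ^ (p - 2) = (t ^ (p / 2 + 1)) ^ r := by
    rw [← rpow_mul ht]; congr 1; rw [hr]; field_simp
  set Y := t ^ (p / 2 + 1)
  -- Concavity of `Y^r`: its tangent at `Y = 1` lies above it, with equality exactly at the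
  -- soliton's height.
  have hbern : Y ^ r ≤ 1 + r * (Y - 1) := by
    have := rpow_one_add_le_one_add_mul_self (s := Y - 1) (by linarith) (p := r)
      (by positivity) hr1
    rwa [add_sub_cancel] at this
  have hBb : B ^ (p / 2 + 1) = B ^ 2 * √(p / 2) * √w := by
    have e : √(p / 2) * √w = B ^ ((p - 2) * (1 / 2)) := by
      rw [rpow_mul hB.le, hpeak, ← sqrt_eq_rpow, ← sqrt_mul (by positivity)]; congr 1; ring
    rw [mul_assoc, e, ← rpow_two, ← rpow_add hB]; congr 1; ring
  have hsq : √(2 / p) * √(p / 2) = 1 := by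
    rw [← sqrt_mul (by positivity)]; field_simp; simp
  have hsw := mul_self_sqrt hw0.le
  have hcrit : 2 * √(2 / p) * (J / (p + 2)) * B ^ (p / 2 + 1) = m * w * r / 2 := by
    rw [hBb, hr]
    have : 2 * √(2 / p) * (J / (p + 2)) * (B ^ 2 * √(p / 2) * √w)
        = 2 * (√(2 / p) * √(p / 2)) * (B ^ 2 * J) * √w / (p + 2) := by ring
    rw [this, hsq, hmass]
    linear_combination (m * (p - 2) / (p + 2)) * hsw
  rw [mul_rpow ht hB.le, mul_rpow ht hB.le, hpeak, hY, hbind]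
  have e1 : 2 * √(2 / p) * (J / (p + 2)) * (Y * B ^ (p / 2 + 1)) = m * w * r / 2 * Y := by
    rw [← hcrit]; ring
  have e2 : m / p * (Y ^ r * (p * w / 2)) = m * w / 2 * Y ^ r := by field_simp
  have e3 : w * (6 - p) / (2 * (p + 2)) * m = m * w / 2 * (1 - r) := by
    rw [hr]; field_simp; ring
  rw [show t ^ (p / 2 + 1) = Y from rfl, e1, e2, e3]
  nlinarith [mul_le_mul_of_nonneg_left hbern (show 0 ≤ m * w / 2 by positivity)]

end Soliton

namespace MetricGraph

open Real Set Filter Topology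

/-! ### The chain rule for functions with an integrable upper gradient -/

/-- It transfers absolute continuity from the primitive of an upper gradient `g` to `n`, and then
from `n` to `Ψ ∘ n`. -/
lemma absolutelyContinuousOnInterval_of_dist_le {h G : ℝ → ℝ} {a b C : ℝ}
    (hG : AbsolutelyContinuousOnInterval G a b)
    (hle : ∀ x ∈ uIcc a b, ∀ y ∈ uIcc a b, dist (h x) (h y) ≤ C * dist (G x) (G y)) :
    AbsolutelyContinuousOnInterval h a b := by
  unfold AbsolutelyContinuousOnInterval at hG ⊢
  refine squeeze_zero' (Eventually.of_forall fun _ => Finset.sum_nonneg fun _ _ => dist_nonneg) ?_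
    (by simpa using hG.const_mul C)
  rw [eventually_inf_principal]
  filter_upwards with E hE
  rw [Finset.mul_sum]
  exact Finset.sum_le_sum fun i hi => hle _ (hE.1 i hi).1 _ (hE.1 i hi).2

section UpperGradient

variable {n g : ℝ → ℝ} {a b : ℝ}

lemma dist_le_dist_integral (hab : a ≤ b) (hg : IntervalIntegrable g volume a b)
    (hng : ∀ x y, a ≤ x → x ≤ y → y ≤ b → |n y - n x| ≤ ∫ t in x..y, g t) :
    ∀ x ∈ uIcc a b, ∀ y ∈ uIcc a b,
      dist (n x) (n y) ≤ dist (∫ t in a..x, g t) (∫ t in a..y, g t) := by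
  have key : ∀ x ∈ Icc a b, ∀ y ∈ Icc a b, x ≤ y →
      dist (n x) (n y) ≤ dist (∫ t in a..x, g t) (∫ t in a..y, g t) := fun x hx y hy hxy => by
    have hs : ∀ z ∈ Icc a b, IntervalIntegrable g volume a z := fun z hz =>
      hg.mono_set (by rw [uIcc_of_le hab, uIcc_of_le hz.1]; exact Icc_subset_Icc_right hz.2)
    rw [dist_comm, dist_comm (∫ t in a..x, g t), Real.dist_eq, Real.dist_eq,
      intervalIntegral.integral_interval_sub_left (hs y hy) (hs x hx)]
    exact (hng x y hx.1 hxy hy.2).trans (le_abs_self _)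
  rw [uIcc_of_le hab]
  intro x hx y hy
  rcases le_total x y with h | h
  · exact key x hx y hy h
  · rw [dist_comm, dist_comm (∫ t in a..x, g t)]; exact key y hy x hx h

/-- A function with upper gradient `g` satisfies the chain rule, as an inequality. -/
lemma sub_le_integral_of_upperGradient (hab : a ≤ b) (hg : IntervalIntegrable g volume a b)
    (hng : ∀ x y, a ≤ x → x ≤ y → y ≤ b → |n y - n x| ≤ ∫ t in x..y, g t)
    {Ψ F : ℝ → ℝ} (hΨ : ∀ s, HasDerivAt Ψ (F s) s) (hF : Continuous F) :
    Ψ (n b) - Ψ (n a) ≤ ∫ x in a..b, |F (n x)| * g x := by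
  have hG := hg.absolutelyContinuousOnInterval_intervalIntegral (c := a) left_mem_uIcc
  have hdist := dist_le_dist_integral hab hg hng
  have hn : AbsolutelyContinuousOnInterval n a b :=
    absolutelyContinuousOnInterval_of_dist_le (C := 1) hG (by simpa using hdist)
  obtain ⟨N, hN⟩ := hn.exists_bound
  have hΨ1 : ContDiff ℝ 1 Ψ := contDiff_one_iff_deriv.2
    ⟨fun s => (hΨ s).differentiableAt, by rwa [show deriv Ψ = F from funext fun s => (hΨ s).deriv]⟩
  -- `Ψ` is only locally Lipschitz, which suffices since `n` has bounded range on the interval.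
  obtain ⟨K, hK⟩ := hΨ1.contDiffOn.exists_lipschitzOnWith (by decide)
    (convex_Icc (-N) N) isCompact_Icc
  have hmem : ∀ x ∈ uIcc a b, n x ∈ Icc (-N) N := fun x hx => abs_le.1 (hN x hx)
  have hh : AbsolutelyContinuousOnInterval (Ψ ∘ n) a b :=
    absolutelyContinuousOnInterval_of_dist_le (C := K) hn
      fun x hx y hy => hK.dist_le_mul _ (hmem x hx) _ (hmem y hy)
  have hFn : ContinuousOn (fun x => |F (n x)|) (uIcc a b) :=
    (hF.comp_continuousOn hn.continuousOn).abs
  have h := hh.integral_deriv_eq_sub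
  simp only [Function.comp_apply] at h
  rw [← h]
  refine intervalIntegral.integral_mono_ae_restrict hab hh.intervalIntegrable_deriv
    (hg.continuousOn_mul hFn) ?_
  rw [EventuallyLE, ae_restrict_iff' measurableSet_Icc]
  -- Endpoints are discarded so that difference quotients can be compared on a two-sided
  -- neighbourhood.
  have hne : ∀ c : ℝ, ∀ᵐ x : ℝ, x ≠ c := fun c => by simp [ae_iff, measure_singleton]
  filter_upwards [hn.ae_differentiableAt, hg.ae_hasDerivAt_integral, hne a, hne b]
    with x hx1 hx2 hxa hxb hx
  rw [← uIcc_of_le hab] at hx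
  have hd := (hx1 hx).hasDerivAt
  have hGd := hx2 hx a left_mem_uIcc
  -- Difference quotients of `n` are dominated by those of the primitive of `g`, which is monotone
  -- because its increments bound absolute values; so `g x ≥ 0` at almost every `x`.
  have hle : |deriv n x| ≤ g x := by
    have t1 := hd.tendsto_slope.abs
    have t2 := hGd.tendsto_slope.abs
    have hnb : uIcc a b ∈ 𝓝[≠] x := by
      rw [uIcc_of_le hab] at hx ⊢
      exact mem_nhdsWithin_of_mem_nhds
        (Icc_mem_nhds (lt_of_le_of_ne hx.1 hxa.symm) (lt_of_le_of_ne hx.2 hxb))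
    have hgx : 0 ≤ g x := by
      refine ge_of_tendsto hGd.tendsto_slope ?_
      filter_upwards [hnb] with y hy
      rw [uIcc_of_le hab] at hx hy
      have hmono : ∀ u ∈ Icc a b, ∀ v ∈ Icc a b, u ≤ v →
          ∫ t in a..u, g t ≤ ∫ t in a..v, g t := fun u hu v hv huv => by
        have hs : ∀ z ∈ Icc a b, IntervalIntegrable g volume a z := fun z hz =>
          hg.mono_set (by rw [uIcc_of_le hab, uIcc_of_le hz.1]; exact Icc_subset_Icc_right hz.2)
        have := intervalIntegral.integral_interval_sub_left (hs v hv) (hs u hu)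
        have h0 := (abs_nonneg _).trans (hng u v hu.1 huv hv.2)
        linarith
      rw [slope_def_field]
      rcases le_total x y with hxy | hxy
      · exact div_nonneg (sub_nonneg.2 (hmono x hx y hy hxy)) (sub_nonneg.2 hxy)
      · exact div_nonneg_of_nonpos (sub_nonpos.2 (hmono y hy x hx hxy)) (sub_nonpos.2 hxy)
    rw [← abs_of_nonneg hgx]
    refine le_of_tendsto_of_tendsto t1 t2 ?_
    filter_upwards [hnb] with y hy
    rw [slope_def_field, slope_def_field, abs_div, abs_div]
    exact div_le_div_of_nonneg_right (hdist y hy x hx) (abs_nonneg _)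
  have hch : deriv (Ψ ∘ n) x = F (n x) * deriv n x := ((hΨ (n x)).comp x hd).deriv
  rw [hch]
  calc F (n x) * deriv n x ≤ |F (n x) * deriv n x| := le_abs_self _
    _ = |F (n x)| * |deriv n x| := abs_mul _ _
    _ ≤ |F (n x)| * g x := mul_le_mul_of_nonneg_left hle (abs_nonneg _)

lemma continuousOn_of_upperGradient (hab : a ≤ b) (hg : IntervalIntegrable g volume a b)
    (hng : ∀ x y, a ≤ x → x ≤ y → y ≤ b → |n y - n x| ≤ ∫ t in x..y, g t) :
    ContinuousOn n (Icc a b) := by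
  have hG := hg.absolutelyContinuousOnInterval_intervalIntegral (c := a) left_mem_uIcc
  rw [← uIcc_of_le hab]
  exact (absolutelyContinuousOnInterval_of_dist_le (C := 1) hG
    (by simpa using dist_le_dist_integral hab hg hng)).continuousOn

end UpperGradient

/-- An integrable function on a half-line takes small values arbitrarily far out. -/
lemma exists_lt_of_integrableOn_Ioi {q : ℝ → ℝ} {R : ℝ} (hq : IntegrableOn q (Ioi R)) (S : ℝ)
    {ε : ℝ} (hε : 0 < ε) : ∃ b, S ≤ b ∧ q b < ε := by
  -- Otherwise a positive constant would be integrable on a half-line.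
  by_contra! h
  have h1 : IntegrableOn (fun _ : ℝ => ε) (Ioi (max R S)) := by
    refine Integrable.mono' (hq.mono_set (Ioi_subset_Ioi (le_max_left R S)))
      aestronglyMeasurable_const ?_
    filter_upwards [ae_restrict_mem measurableSet_Ioi] with x hx
    rw [norm_of_nonneg hε.le]
    exact h x ((le_max_right R S).trans (le_of_lt hx))
  rw [integrableOn_const_iff] at h1
  simp [hε.ne'] at h1

/-! ### The energy on a half-line -/

section HalfLine

variable {p R B : ℝ} {n g : ℝ → ℝ}

/-- The phase-plane lower bound for the energy of a function on a half-line. -/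
lemma neg_binding_sub_le_halfLine (hp2 : 2 < p) (hp6 : p < 6)
    (hn0 : ∀ x, R ≤ x → 0 ≤ n x) (hnB : ∀ x, R ≤ x → n x ≤ B)
    (hn2 : IntegrableOn (fun x => n x ^ 2) (Ioi R)) (hg0 : ∀ x, 0 ≤ g x)
    (hgm : AEStronglyMeasurable g (volume.restrict (Ioi R)))
    (hg2 : IntegrableOn (fun x => g x ^ 2) (Ioi R))
    (hgi : ∀ x y, R ≤ x → x ≤ y → IntervalIntegrable g volume x y)
    (hng : ∀ x y, R ≤ x → x ≤ y → |n y - n x| ≤ ∫ t in x..y, g t) :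
    -Soliton.binding p (∫ x in Ioi R, n x ^ 2) - √(2 / p) / 2 * B ^ (p / 2 - 1) * n R ^ 2
      ≤ 1 / 2 * (∫ x in Ioi R, g x ^ 2) - 1 / p * ∫ x in Ioi R, n x ^ p := by
  have hp0 : 0 < p := by linarith
  have hnc : ContinuousOn n (Ici R) := fun x hx => by
    have h := continuousOn_of_upperGradient (n := n) (a := R) (b := x + 1)
      (by linarith [mem_Ici.1 hx]) (hgi R (x + 1) le_rfl (by linarith [mem_Ici.1 hx]))
      fun y z hy hyz _ => hng y z hy hyz
    refine (h x ⟨hx, by linarith⟩).mono_of_mem_nhdsWithin ?_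
    have : Iic (x + 1) ∈ 𝓝[Ici R] x := mem_nhdsWithin_of_mem_nhds (Iic_mem_nhds (by linarith))
    exact inter_mem self_mem_nhdsWithin this
  have hg2' : 0 ≤ ∫ x in Ioi R, g x ^ 2 := integral_nonneg fun x => sq_nonneg _
  have hB0 : 0 ≤ B := (hn0 R le_rfl).trans (hnB R le_rfl)
  have hbdd : BddAbove (n '' Ici R) := ⟨B, by rintro _ ⟨x, hx, rfl⟩; exact hnB x hx⟩
  have hne : (n '' Ici R).Nonempty := ⟨n R, R, self_mem_Ici, rfl⟩
  set M := sSup (n '' Ici R) with hMdef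
  have hnM : ∀ x, R ≤ x → n x ≤ M := fun x hx => le_csSup hbdd ⟨x, hx, rfl⟩
  have hMB : M ≤ B := csSup_le hne (by rintro _ ⟨x, hx, rfl⟩; exact hnB x hx)
  have hM0 : 0 ≤ M := (hn0 R le_rfl).trans (hnM R le_rfl)
  rcases hM0.eq_or_lt with hM | hM
  -- The case `M = 0` is separate because the profile below is rescaled by `M`.
  · have hz : ∀ x, R ≤ x → n x = 0 := fun x hx => le_antisymm (hM ▸ hnM x hx) (hn0 x hx)
    have i1 : ∫ x in Ioi R, n x ^ 2 = 0 := by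
      rw [setIntegral_congr_fun (g := fun _ => (0 : ℝ)) measurableSet_Ioi fun x hx => by
        simp only [hz x (le_of_lt hx)]; norm_num]
      simp
    have i2 : ∫ x in Ioi R, n x ^ p = 0 := by
      rw [setIntegral_congr_fun (g := fun _ => (0 : ℝ)) measurableSet_Ioi fun x hx => by
        simp only [hz x (le_of_lt hx)]; exact zero_rpow hp0.ne']
      simp
    rw [i1, i2, Soliton.binding_zero hp2 hp6, hz R le_rfl]
    norm_num
    linarith
  -- Chosen so that `F(s)² = (2/p)(M^(p-2) s² - s^p)` for `0 ≤ s ≤ M`: the homoclinic orbit whose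
  -- peak is exactly `M`. `Ψ` is the primitive of `F` vanishing at `0`.
  set c := √(2 / p) * M ^ (p / 2) with hc
  have hc0 : 0 < c := by positivity
  set F : ℝ → ℝ := fun s => c * Soliton.orbit p (s / M) with hFdef
  set Ψ : ℝ → ℝ := fun s => c * M * Soliton.orbitArea p (s / M) with hΨdef
  have hF0 : ∀ s, 0 ≤ F s := fun s => mul_nonneg hc0.le (Soliton.orbit_nonneg _ _)
  have hFc : Continuous F :=
    continuous_const.mul ((Soliton.continuous_orbit hp0).comp (continuous_id.div_const M))
  have hΨd : ∀ s, HasDerivAt Ψ (F s) s := fun s => by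
    refine (((Soliton.hasDerivAt_orbitArea hp0 (s / M)).comp s
      ((hasDerivAt_id s).div_const M)).const_mul (c * M)).congr_deriv ?_
    simp only [hFdef]; field_simp
  have hc2 : c ^ 2 = 2 / p * M ^ p := by
    rw [hc, mul_pow, sq_sqrt (by positivity), ← rpow_two (M ^ _), ← rpow_mul hM.le]
    congr 2; ring
  have hMp : M ^ p = M ^ (p - 2) * M ^ 2 := by
    rw [← rpow_two, ← rpow_add hM]; congr 1; ring
  have hFsq : ∀ x, R ≤ x → F (n x) ^ 2 = 2 / p * (M ^ (p - 2) * n x ^ 2 - n x ^ p) := fun x hx => by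
    simp only [hFdef]
    rw [mul_pow, Soliton.orbit_sq hp2 (div_nonneg (hn0 x hx) hM.le)
      ((div_le_one hM).2 (hnM x hx)), hc2, div_rpow (hn0 x hx) hM.le, hMp]
    have : M ^ (p - 2) ≠ 0 := (rpow_pos_of_pos hM _).ne'
    field_simp
  have hnp : IntegrableOn (fun x => n x ^ p) (Ioi R) := by
    refine Integrable.mono' (hn2.const_mul (M ^ (p - 2)))
      ((hnc.mono Ioi_subset_Ici_self).rpow_const (fun _ _ => Or.inr hp0.le)
        |>.aestronglyMeasurable measurableSet_Ioi) ?_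
    filter_upwards [ae_restrict_mem measurableSet_Ioi] with x hx
    have hx' : R ≤ x := le_of_lt hx
    rw [norm_of_nonneg (rpow_nonneg (hn0 x hx') _)]
    have h := (sq_nonneg _).trans_eq (hFsq x hx')
    linarith [(mul_nonneg_iff_of_pos_left (show 0 < 2 / p by positivity)).1 h]
  have hF2 : IntegrableOn (fun x => F (n x) ^ 2) (Ioi R) := by
    refine (((hn2.const_mul (M ^ (p - 2))).sub hnp).const_mul (2 / p)).congr ?_
    filter_upwards [ae_restrict_mem measurableSet_Ioi] with x hx
    exact (hFsq x (le_of_lt hx)).symm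
  have hFm : AEStronglyMeasurable (fun x => F (n x)) (volume.restrict (Ioi R)) :=
    (hFc.comp_continuousOn (hnc.mono Ioi_subset_Ici_self)).aestronglyMeasurable measurableSet_Ioi
  have hyoung : ∀ x, F (n x) * g x ≤ 1 / 2 * g x ^ 2 + 1 / 2 * F (n x) ^ 2 := fun x => by
    nlinarith [sq_nonneg (g x - F (n x))]
  have hFg : IntegrableOn (fun x => F (n x) * g x) (Ioi R) := by
    refine Integrable.mono' ((hg2.const_mul (1 / 2)).add (hF2.const_mul (1 / 2)))
      (hFm.mul hgm) (Eventually.of_forall fun x => ?_)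
    rw [norm_of_nonneg (mul_nonneg (hF0 _) (hg0 x))]
    exact hyoung x
  have hΨle : ∀ s, 0 ≤ s → Ψ s ≤ √(2 / p) / 2 * M ^ (p / 2 - 1) * s ^ 2 := fun s hs => by
    have h := Soliton.orbitArea_le (p := p) hp0 (div_nonneg hs hM.le)
    calc Ψ s ≤ c * M * ((s / M) ^ 2 / 2) := mul_le_mul_of_nonneg_left h (by positivity)
      _ = _ := by
        rw [hc, rpow_sub_one hM.ne']; field_simp
  set D := √(2 / p) / 2 * M ^ (p / 2 - 1) with hD
  have hD0 : 0 ≤ D := by positivity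
  set I := ∫ x in Ioi R, F (n x) * g x with hI
  -- The variation of `Ψ ∘ n` is counted on `[R, x]` and again on `[x, b]`, where `b` is so far out
  -- that `Ψ (n b)` is negligible.
  have hsup : ∀ x, R ≤ x → 2 * Ψ (n x) ≤ I + Ψ (n R) := fun x hx => by
    refine le_of_forall_pos_le_add fun ε hε => ?_
    obtain ⟨b, hxb, hb⟩ := exists_lt_of_integrableOn_Ioi hn2 x (ε := ε / (D + 1)) (by positivity)
    have hRb := hx.trans hxb
    have h1 := sub_le_integral_of_upperGradient (n := n) hx (hgi R x le_rfl hx)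
      (fun y z hy hyz _ => hng y z hy hyz) hΨd hFc
    -- The descent from `x` to `b` is the chain rule for `-Ψ`.
    have h2 := sub_le_integral_of_upperGradient (n := n) (Ψ := fun s => -Ψ s) (F := fun s => -F s)
      hxb (hgi x b hx hxb) (fun y z hy hyz _ => hng y z (hx.trans hy) hyz)
      (fun s => (hΨd s).neg) hFc.neg
    simp only [abs_neg, abs_of_nonneg (hF0 _)] at h1 h2
    have hi : IntervalIntegrable (fun x => F (n x) * g x) volume R b :=
      (intervalIntegrable_iff_integrableOn_Ioc_of_le hRb).2 (hFg.mono_set Ioc_subset_Ioi_self)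
    have h3 := intervalIntegral.integral_add_adjacent_intervals
      (hi.mono_set (by rw [uIcc_of_le hx, uIcc_of_le hRb]; exact Icc_subset_Icc_right hxb))
      (hi.mono_set (by rw [uIcc_of_le hxb, uIcc_of_le hRb]; exact Icc_subset_Icc_left hx))
    have h4 : ∫ x in R..b, F (n x) * g x ≤ I := by
      rw [intervalIntegral.integral_of_le hRb]
      exact setIntegral_mono_set hFg (Eventually.of_forall fun x => mul_nonneg (hF0 _) (hg0 x))
        Ioc_subset_Ioi_self.eventuallyLE
    have h5 : Ψ (n b) ≤ ε := by
      refine (hΨle _ (hn0 b hRb)).trans ?_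
      calc D * n b ^ 2 ≤ D * (ε / (D + 1)) := mul_le_mul_of_nonneg_left hb.le hD0
        _ ≤ (D + 1) * (ε / (D + 1)) := mul_le_mul_of_nonneg_right (by linarith) (by positivity)
        _ = ε := by field_simp
    linarith
  have hΨcont : Continuous Ψ := continuous_iff_continuousAt.2 fun s => (hΨd s).continuousAt
  -- Closedness carries the bound from the values of `n` to their supremum, so attainment of `M` is
  -- not needed.
  have hclosed : IsClosed {s | 2 * Ψ s ≤ I + Ψ (n R)} :=
    isClosed_le (continuous_const.mul hΨcont) continuous_const
  have hΨM : 2 * Ψ M ≤ I + Ψ (n R) :=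
    hclosed.closure_subset_iff.2 (by rintro _ ⟨x, hx, rfl⟩; exact hsup x hx)
      (csSup_mem_closure hne hbdd)
  have hIle : I ≤ 1 / 2 * (∫ x in Ioi R, g x ^ 2)
      + 1 / p * (M ^ (p - 2) * (∫ x in Ioi R, n x ^ 2) - ∫ x in Ioi R, n x ^ p) := by
    have e : ∫ x in Ioi R, F (n x) ^ 2
        = 2 / p * (M ^ (p - 2) * (∫ x in Ioi R, n x ^ 2) - ∫ x in Ioi R, n x ^ p) := by
      rw [← integral_const_mul (M ^ (p - 2)), ← integral_sub (hn2.const_mul _) hnp,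
        ← integral_const_mul]
      exact setIntegral_congr_fun measurableSet_Ioi fun x hx => hFsq x (le_of_lt hx)
    calc I ≤ ∫ x in Ioi R, (1 / 2 * g x ^ 2 + 1 / 2 * F (n x) ^ 2) :=
          integral_mono hFg ((hg2.const_mul _).add (hF2.const_mul _)) hyoung
      _ = _ := by
          rw [integral_add (hg2.const_mul _) (hF2.const_mul _), integral_const_mul,
            integral_const_mul, e]
          ring
  have hΨM' : Ψ M = √(2 / p) * Soliton.orbitArea p 1 * M ^ (p / 2 + 1) := by
    simp only [hΨdef, hc]
    rw [div_self hM.ne', rpow_add_one hM.ne']; ring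
  have hfin := Soliton.neg_binding_le hp2 hp6 (m := ∫ x in Ioi R, n x ^ 2)
    (integral_nonneg fun x => sq_nonneg _) hM.le
  have hDB : D * n R ^ 2 ≤ √(2 / p) / 2 * B ^ (p / 2 - 1) * n R ^ 2 := by
    refine mul_le_mul_of_nonneg_right (mul_le_mul_of_nonneg_left ?_ (by positivity)) (sq_nonneg _)
    exact rpow_le_rpow hM.le hMB (by linarith)
  have hΨR := hΨle (n R) (hn0 R le_rfl)
  have e2 : (∫ x in Ioi R, n x ^ 2) / p * M ^ (p - 2)
      = 1 / p * (M ^ (p - 2) * ∫ x in Ioi R, n x ^ 2) := by ring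
  rw [e2] at hfin
  linarith

end HalfLine

variable {V E H : Type*} {G : MetricGraph V E H}

/-! ### Functions in `H¹` on a single edge -/

lemma measurableSet_interval (e : E ⊕ H) : MeasurableSet (G.interval e) := by
  rcases e with e | h
  exacts [measurableSet_Icc, measurableSet_Ici]

lemma interval_nonneg {e : E ⊕ H} {x : ℝ} (hx : x ∈ G.interval e) : 0 ≤ x := by
  rcases e with e | h
  exacts [hx.1, hx]

lemma zero_mem_interval (e : E ⊕ H) : (0 : ℝ) ∈ G.interval e := by
  rcases e with e | h
  exacts [⟨le_rfl, (G.len_pos e).le⟩, self_mem_Ici]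

lemma Icc_subset_interval {e : E ⊕ H} {x y : ℝ} (hx : 0 ≤ x) (hy : y ∈ G.interval e) :
    Icc x y ⊆ G.interval e := by
  rcases e with e | h
  exacts [Icc_subset_Icc hx hy.2, fun z hz => hx.trans hz.1]

namespace H1

variable (u : G.H1) {e : E ⊕ H} {x y : ℝ}

lemma integrableOn_der_sq (e : E ⊕ H) :
    IntegrableOn (fun x => ‖u.der e x‖ ^ 2) (G.interval e) :=
  (u.memLp_der e).integrable_norm_pow (by norm_num)

lemma integrableOn_sq (e : E ⊕ H) :
    IntegrableOn (fun x => ‖u.toFun e x‖ ^ 2) (G.interval e) :=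
  (u.memLp_toFun e).integrable_norm_pow (by norm_num)

lemma intervalIntegrable_der (hx : 0 ≤ x) (hxy : x ≤ y) (hy : y ∈ G.interval e) :
    IntervalIntegrable (u.der e) volume x y := by
  rw [intervalIntegrable_iff_integrableOn_Icc_of_le hxy]
  exact ((u.memLp_der e).mono_measure
    (Measure.restrict_mono (Icc_subset_interval hx hy) le_rfl)).integrable (by norm_num)

lemma abs_norm_sub_le_integral (hx : 0 ≤ x) (hxy : x ≤ y) (hy : y ∈ G.interval e) :
    |‖u.toFun e y‖ - ‖u.toFun e x‖| ≤ ∫ t in x..y, ‖u.der e t‖ := by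
  have hx' : x ∈ G.interval e := Icc_subset_interval hx hy ⟨le_rfl, hxy⟩
  have h : u.toFun e y - u.toFun e x = ∫ t in x..y, u.der e t := by
    rw [u.eq_add_integral e y hy, u.eq_add_integral e x hx', add_sub_add_left_eq_sub,
      intervalIntegral.integral_interval_sub_left
        (u.intervalIntegrable_der le_rfl (hx.trans hxy) hy)
        (u.intervalIntegrable_der le_rfl hx hx')]
  calc |‖u.toFun e y‖ - ‖u.toFun e x‖| ≤ ‖u.toFun e y - u.toFun e x‖ := abs_norm_sub_norm_le _ _
    _ ≤ ∫ t in x..y, ‖u.der e t‖ := by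
        rw [h]; exact intervalIntegral.norm_integral_le_integral_norm hxy

lemma sub_le_integral (hx : 0 ≤ x) (hxy : x ≤ y) (hy : y ∈ G.interval e)
    {Ψ F : ℝ → ℝ} (hΨ : ∀ s, HasDerivAt Ψ (F s) s) (hF : Continuous F) :
    Ψ ‖u.toFun e y‖ - Ψ ‖u.toFun e x‖ ≤ ∫ t in x..y, |F ‖u.toFun e t‖| * ‖u.der e t‖ :=
  sub_le_integral_of_upperGradient (n := fun t => ‖u.toFun e t‖) hxy
    (u.intervalIntegrable_der hx hxy hy).norm
    (fun _ _ hs hst ht => u.abs_norm_sub_le_integral (hx.trans hs) hst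
      (Icc_subset_interval (hx.trans (hs.trans hst)) hy ⟨le_rfl, ht⟩)) hΨ hF

lemma aestronglyMeasurable (e : E ⊕ H) :
    AEStronglyMeasurable (u.toFun e) (volume.restrict (G.interval e)) := (u.memLp_toFun e).1

/-- The pointwise form of the one-dimensional Gagliardo-Nirenberg inequality. -/
lemma norm_sq_sub_norm_sq_le (hx : x ∈ G.interval e) (hy : y ∈ G.interval e) {l : ℝ} (hl : 0 < l) :
    ‖u.toFun e x‖ ^ 2 - ‖u.toFun e y‖ ^ 2 ≤ l * (∫ t in G.interval e, ‖u.toFun e t‖ ^ 2)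
      + (∫ t in G.interval e, ‖u.der e t‖ ^ 2) / l := by
  -- Young's inequality with weight `l` dominates `2|u||u'|`, the bound on the derivative of `|u|²`.
  set f : ℝ → ℝ := fun t => l * ‖u.toFun e t‖ ^ 2 + ‖u.der e t‖ ^ 2 / l with hf
  have hfi : IntegrableOn f (G.interval e) :=
    ((u.integrableOn_sq e).const_mul l).add ((u.integrableOn_der_sq e).div_const l)
  have hf0 : ∀ t, 0 ≤ f t := fun t => by positivity
  have hint : ∀ a b, 0 ≤ a → a ≤ b → b ∈ G.interval e →
      ∫ t in a..b, |2 * ‖u.toFun e t‖| * ‖u.der e t‖ ≤ ∫ t in G.interval e, f t :=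
    fun a b ha hab hb => by
      have hsub := (Ioc_subset_Icc_self).trans (Icc_subset_interval ha hb)
      rw [intervalIntegral.integral_of_le hab]
      refine (integral_mono_of_nonneg (Eventually.of_forall fun t => by positivity)
        (hfi.mono_set hsub) (Eventually.of_forall fun t => ?_)).trans
        (setIntegral_mono_set hfi (Eventually.of_forall hf0) hsub.eventuallyLE)
      have h := sq_nonneg (l * ‖u.toFun e t‖ - ‖u.der e t‖)
      simp only [hf]
      rw [abs_of_nonneg (by positivity), ← sub_nonneg]
      have : l * ‖u.toFun e t‖ ^ 2 + ‖u.der e t‖ ^ 2 / l - 2 * ‖u.toFun e t‖ * ‖u.der e t‖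
          = (l * ‖u.toFun e t‖ - ‖u.der e t‖) ^ 2 / l := by field_simp; ring
      rw [this]; positivity
  have hsum : ∫ t in G.interval e, f t = l * (∫ t in G.interval e, ‖u.toFun e t‖ ^ 2)
      + (∫ t in G.interval e, ‖u.der e t‖ ^ 2) / l := by
    rw [integral_add ((u.integrableOn_sq e).const_mul l) ((u.integrableOn_der_sq e).div_const l),
      integral_const_mul, integral_div]
  rw [← hsum]
  have hsq : ∀ s : ℝ, HasDerivAt (fun s : ℝ => s ^ 2) (2 * s) s := fun s => by
    simpa using hasDerivAt_pow 2 s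
  rcases le_total y x with h | h
  · exact (u.sub_le_integral (interval_nonneg hy) h hx hsq (continuous_const.mul continuous_id)).trans
      (hint y x (interval_nonneg hy) h hx)
  · have h1 := u.sub_le_integral (interval_nonneg hx) h hy (fun s => (hsq s).neg)
      (continuous_const.mul continuous_id).neg
    have h2 := hint x y (interval_nonneg hx) h hy
    simp only [abs_neg, Pi.neg_apply] at h1
    linarith

lemma integrableOn_rpow {p B : ℝ} (hp : 2 ≤ p) (hB : ∀ x ∈ G.interval e, ‖u.toFun e x‖ ≤ B) :
    IntegrableOn (fun x => ‖u.toFun e x‖ ^ p) (G.interval e) ∧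
      ∫ x in G.interval e, ‖u.toFun e x‖ ^ p
        ≤ B ^ (p - 2) * ∫ x in G.interval e, ‖u.toFun e x‖ ^ 2 := by
  have hle : ∀ x ∈ G.interval e, ‖u.toFun e x‖ ^ p ≤ B ^ (p - 2) * ‖u.toFun e x‖ ^ 2 :=
    fun x hx => by
      have h : ‖u.toFun e x‖ ^ p = ‖u.toFun e x‖ ^ (p - 2) * ‖u.toFun e x‖ ^ 2 := by
        rw [← rpow_two, ← rpow_add_of_nonneg (norm_nonneg _) (by linarith) (by norm_num),
          sub_add_cancel]
      rw [h]
      exact mul_le_mul_of_nonneg_right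
        (rpow_le_rpow (norm_nonneg _) (hB x hx) (by linarith)) (sq_nonneg _)
  have hi : IntegrableOn (fun x => ‖u.toFun e x‖ ^ p) (G.interval e) := by
    refine Integrable.mono' ((u.integrableOn_sq e).const_mul (B ^ (p - 2)))
      ((continuous_rpow_const (by linarith)).comp_aestronglyMeasurable
        (u.aestronglyMeasurable e).norm) ?_
    filter_upwards [ae_restrict_mem (measurableSet_interval e)] with x hx
    rw [norm_of_nonneg (rpow_nonneg (norm_nonneg _) _)]
    exact hle x hx
  refine ⟨hi, ?_⟩
  rw [← integral_const_mul]
  exact setIntegral_mono_on hi ((u.integrableOn_sq e).const_mul _) (measurableSet_interval e) hle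

end H1

/-! ### Coercivity of the energy -/

lemma Cycle.potential_nonneg (γ : G.Cycle) (A : E ⊕ H → ℝ → ℝ) : 0 ≤ γ.potential A := by
  unfold Cycle.potential
  positivity

variable [Fintype E]

section Cycles

variable [Fintype V]

/-- The potential energy of the cycles. -/
def cycleEnergy (A : E ⊕ H → ℝ → ℝ) (C : G.IndependentCycles) (u : G.H1) : ℝ :=
  ∑ i : Fin G.cyclomaticNumber, ((C.cycle i).steps.map fun s =>
    ∫ x in G.interval (Sum.inl s.1), (C.cycle i).potential A * ‖u.toFun (Sum.inl s.1) x‖ ^ 2).sum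

lemma cycleEnergy_nonneg (A : E ⊕ H → ℝ → ℝ) (C : G.IndependentCycles) (u : G.H1) :
    0 ≤ cycleEnergy A C u := by
  refine Finset.sum_nonneg fun i _ => List.sum_nonneg fun y hy => ?_
  obtain ⟨s, -, rfl⟩ := List.mem_map.1 hy
  exact integral_nonneg fun x => mul_nonneg (Cycle.potential_nonneg _ _) (sq_nonneg _)

end Cycles

variable [Fintype H]

/-- The squared `L²` norm of the derivative. -/
def kinetic (u : G.H1) : ℝ := ∑ e, ∫ x in G.interval e, ‖u.der e x‖ ^ 2

lemma kinetic_nonneg (u : G.H1) : 0 ≤ kinetic u :=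
  Finset.sum_nonneg fun _ _ => integral_nonneg fun _ => sq_nonneg _

lemma mass_nonneg (u : G.H1) : 0 ≤ mass u :=
  Finset.sum_nonneg fun _ _ => integral_nonneg fun _ => sq_nonneg _

lemma integral_sq_le_mass (u : G.H1) (e : E ⊕ H) :
    ∫ x in G.interval e, ‖u.toFun e x‖ ^ 2 ≤ mass u :=
  Finset.single_le_sum (f := fun e => ∫ x in G.interval e, ‖u.toFun e x‖ ^ 2)
    (fun _ _ => integral_nonneg fun _ => sq_nonneg _) (Finset.mem_univ e)

lemma integral_der_sq_le_kinetic (u : G.H1) (e : E ⊕ H) :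
    ∫ x in G.interval e, ‖u.der e x‖ ^ 2 ≤ kinetic u :=
  Finset.single_le_sum (f := fun e => ∫ x in G.interval e, ‖u.der e x‖ ^ 2)
    (fun _ _ => integral_nonneg fun _ => sq_nonneg _) (Finset.mem_univ e)

variable (G) in
/-- The uniform norm is controlled by the mass and the square root of the kinetic energy. -/
lemma exists_norm_sq_le (μ : ℝ) (hμ : 0 ≤ μ) : ∃ C, 0 < C ∧ ∀ u : G.H1, mass u ≤ μ →
    ∀ e, ∀ x ∈ G.interval e, ‖u.toFun e x‖ ^ 2 ≤ C * √(1 + kinetic u) := by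
  -- `K e` bounds `|u|²` at some point of the edge: on a bounded edge by averaging the mass (`μ + 1`
  -- makes the contradiction strict), on a half-line by smallness far out.
  set K : E ⊕ H → ℝ := Sum.elim (fun e => (μ + 1) / G.len e) fun _ => 1 with hK
  have hK0 : ∀ e, 0 ≤ K e := by
    rintro (e | h)
    exacts [div_nonneg (by linarith) (G.len_pos e).le, zero_le_one]
  have hKsum : 0 ≤ ∑ e, K e := Finset.sum_nonneg fun e _ => hK0 e
  refine ⟨∑ e, K e + μ + 1, by linarith, fun u hu e x hx => ?_⟩
  have hy : ∃ y ∈ G.interval e, ‖u.toFun e y‖ ^ 2 ≤ K e := by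
    rcases e with e | h
    · by_contra! hc
      have hlen := G.len_pos e
      have h1 : ∫ _ in G.interval (Sum.inl e), (μ + 1) / G.len e
          ≤ ∫ y in G.interval (Sum.inl e), ‖u.toFun (Sum.inl e) y‖ ^ 2 :=
        setIntegral_mono_on (integrableOn_const (by simp [interval])) (u.integrableOn_sq _)
          (measurableSet_interval _) fun y hy => (hc y hy).le
      have h2 := integral_sq_le_mass u (Sum.inl e)
      have h3 : ∫ _ in G.interval (Sum.inl e), (μ + 1) / G.len e = μ + 1 := by
        rw [setIntegral_const]
        simp [interval, hlen.le]
        field_simp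
      linarith
    · obtain ⟨b, hb0, hb⟩ := exists_lt_of_integrableOn_Ioi
        ((u.integrableOn_sq (Sum.inr h)).mono_set Ioi_subset_Ici_self) 0 one_pos
      exact ⟨b, hb0, hb.le⟩
  obtain ⟨y, hy, hyK⟩ := hy
  have hD := kinetic_nonneg u
  -- This weight balances `l * μ` against `kinetic u / l`: both are at most a constant times `√(1 +
  -- kinetic u)`.
  set l := √(1 + kinetic u) with hl
  have hl1 : 1 ≤ l := one_le_sqrt.2 (by linarith)
  have hl2 : l ^ 2 = 1 + kinetic u := sq_sqrt (by linarith)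
  have h := u.norm_sq_sub_norm_sq_le hx hy (l := l) (by linarith)
  have h1 : l * (∫ t in G.interval e, ‖u.toFun e t‖ ^ 2) ≤ l * μ :=
    mul_le_mul_of_nonneg_left ((integral_sq_le_mass u e).trans hu) (by linarith)
  have h2 : (∫ t in G.interval e, ‖u.der e t‖ ^ 2) / l ≤ l := by
    rw [div_le_iff₀ (by linarith)]
    linarith [integral_der_sq_le_kinetic u e, sq l]
  have h3 : K e ≤ ∑ e, K e := Finset.single_le_sum (fun e _ => hK0 e) (Finset.mem_univ e)
  have h4 : ∑ e, K e ≤ (∑ e, K e) * l :=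
    le_mul_of_one_le_right hKsum hl1
  linarith

lemma exists_norm_le (u : G.H1) : ∃ B, ∀ e, ∀ x ∈ G.interval e, ‖u.toFun e x‖ ≤ B := by
  obtain ⟨C, -, hC⟩ := exists_norm_sq_le G (mass u) (mass_nonneg u)
  exact ⟨√(C * √(1 + kinetic u)), fun e x hx => le_sqrt_of_sq_le (hC u le_rfl e x hx)⟩

/-- A sublinear power is dominated by an arbitrarily small multiple of the identity, up to a
constant. -/
lemma exists_rpow_le {r ε : ℝ} (hr0 : 0 ≤ r) (hr1 : r < 1) (hε : 0 < ε) :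
    ∃ K, ∀ y : ℝ, 0 ≤ y → y ^ r ≤ ε * y + K := by
  have h : Tendsto (fun y : ℝ => y ^ (r - 1)) atTop (𝓝 0) := by
    simpa using tendsto_rpow_neg_atTop (show 0 < 1 - r by linarith)
  obtain ⟨Y, hY⟩ := eventually_atTop.1 (h.eventually (ge_mem_nhds hε))
  set Z := max Y 1
  refine ⟨Z ^ r, fun y hy => ?_⟩
  rcases le_total Z y with hZ | hZ
  · have hy0 : 0 < y := lt_of_lt_of_le (by positivity) hZ
    have h1 := hY y ((le_max_left _ _).trans hZ)
    have h2 : y ^ r = y ^ (r - 1) * y := by rw [rpow_sub_one hy0.ne']; field_simp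
    have : 0 ≤ Z ^ r := by positivity
    rw [h2]
    nlinarith
  · have := rpow_le_rpow hy hZ hr0
    have : 0 ≤ ε * y := by positivity
    linarith

variable [Fintype V]

lemma effectiveEnergy_eq (p : ℝ) (A : E ⊕ H → ℝ → ℝ) (C : G.IndependentCycles) (u : G.H1) :
    effectiveEnergy p A C u = 1 / 2 * kinetic u
      - 1 / p * (∑ e, ∫ x in G.interval e, ‖u.toFun e x‖ ^ p) + cycleEnergy A C u := rfl

/-- The energy is coercive on functions of fixed mass. -/
lemma exists_kinetic_le {p : ℝ} (hp2 : 2 < p) (hp6 : p < 6) (μ : ℝ) (hμ : 0 ≤ μ)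
    (A : E ⊕ H → ℝ → ℝ) (C : G.IndependentCycles) : ∃ K, ∀ u : G.H1, mass u = μ →
      1 / 4 * kinetic u ≤ effectiveEnergy p A C u + K := by
  obtain ⟨c, hc, hb⟩ := exists_norm_sq_le G μ hμ
  set d := 1 / p * (c ^ ((p - 2) / 2) * μ) with hd
  have hp0 : 0 < p := by linarith
  have hd0 : 0 ≤ d := by positivity
  -- The potential energy grows like the power `(p-2)/4` of the kinetic energy, sublinear exactly
  -- because `p < 6`. With this `ε` it absorbs at most a quarter of the kinetic energy, since `d /
  -- (d + 1) ≤ 1`.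
  obtain ⟨K, hK⟩ := exists_rpow_le (r := (p - 2) / 4) (ε := 1 / (4 * (d + 1)))
    (by linarith) (by linarith) (by positivity)
  refine ⟨d * K + 1 / 4, fun u hu => ?_⟩
  have hD := kinetic_nonneg u
  set T := kinetic u
  have hpot : ∑ e, ∫ x in G.interval e, ‖u.toFun e x‖ ^ p
      ≤ c ^ ((p - 2) / 2) * (1 + T) ^ ((p - 2) / 4) * μ := by
    rw [← hu, mass, Finset.mul_sum]
    refine Finset.sum_le_sum fun e _ => ?_
    have h := (u.integrableOn_rpow hp2.le fun x hx => le_sqrt_of_sq_le (hb u hu.le e x hx)).2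
    refine h.trans_eq ?_
    congr 1
    rw [sqrt_eq_rpow, ← rpow_mul (by positivity), mul_rpow hc.le (by positivity), sqrt_eq_rpow,
      ← rpow_mul (by linarith)]
    congr 2 <;> ring
  have h1 := hK (1 + T) (by linarith)
  have h2 := cycleEnergy_nonneg A C u
  have h3 : 1 / p * (∑ e, ∫ x in G.interval e, ‖u.toFun e x‖ ^ p)
      ≤ d * (1 + T) ^ ((p - 2) / 4) := by
    calc _ ≤ 1 / p * (c ^ ((p - 2) / 2) * (1 + T) ^ ((p - 2) / 4) * μ) :=
          mul_le_mul_of_nonneg_left hpot (by positivity)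
      _ = _ := by rw [hd]; ring
  have h4 := mul_le_mul_of_nonneg_left h1 hd0
  have h5 : d * (1 / (4 * (d + 1)) * (1 + T)) ≤ 1 / 4 * (1 + T) := by
    rw [← mul_assoc]
    refine mul_le_mul_of_nonneg_right ?_ (by linarith)
    rw [mul_one_div, div_le_div_iff₀ (by positivity) (by norm_num)]
    linarith
  rw [effectiveEnergy_eq]
  change 1 / 4 * T ≤ 1 / 2 * T - _ + _ + _
  linarith

end MetricGraph

namespace MetricGraph

open Real Set Filter Topology ComplexConjugate

/-! ### Compactness of bounded sequences in `H¹` -/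

/-- Extraction of a common subsequence for finitely many hereditary properties. -/
lemma exists_strictMono_forall {ι : Type*} [Fintype ι] {Q : ι → (ℕ → ℕ) → Prop}
    (hex : ∀ (i : ι) (φ : ℕ → ℕ), ∃ ψ : ℕ → ℕ, StrictMono ψ ∧ Q i (φ ∘ ψ))
    (hsub : ∀ (i : ι) (φ ψ : ℕ → ℕ), StrictMono ψ → Q i φ → Q i (φ ∘ ψ)) (φ : ℕ → ℕ) :
    ∃ ψ : ℕ → ℕ, StrictMono ψ ∧ ∀ i, Q i (φ ∘ ψ) := by
  classical
  suffices h : ∀ S : Finset ι, ∃ ψ : ℕ → ℕ, StrictMono ψ ∧ ∀ i ∈ S, Q i (φ ∘ ψ) by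
    simpa using h Finset.univ
  intro S
  induction S using Finset.induction_on with
  | empty => exact ⟨id, strictMono_id, by simp⟩
  | insert i S _ ih =>
    obtain ⟨ψ, hψ, hQ⟩ := ih
    obtain ⟨χ, hχ, hi⟩ := hex i (φ ∘ ψ)
    refine ⟨ψ ∘ χ, hψ.comp hχ, fun j hj => ?_⟩
    rcases Finset.mem_insert.1 hj with rfl | hj
    · exact hi
    · exact hsub j (φ ∘ ψ) χ hχ (hQ j hj)

/-- Bounded sequences in `L²` have weakly convergent subsequences. -/
lemma exists_weak_limit {S : Set ℝ} {g : ℕ → ℝ → ℂ} {T : ℝ}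
    (hg : ∀ k, MemLp (g k) 2 (volume.restrict S)) (hT : ∀ k, ∫ x in S, ‖g k x‖ ^ 2 ≤ T) :
    ∃ φ : ℕ → ℕ, StrictMono φ ∧ ∃ G : ℝ → ℂ, MemLp G 2 (volume.restrict S) ∧
      ∀ ψ, MemLp ψ 2 (volume.restrict S) →
        Tendsto (fun k => ∫ x in S, inner ℂ (g (φ k) x) (ψ x)) atTop
          (𝓝 (∫ x in S, inner ℂ (G x) (ψ x))) := by
  set ν := volume.restrict S
  set X := Lp ℂ 2 ν
  set f : ℕ → X := fun k => (hg k).toLp (g k) with hf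
  have hnorm : ∀ k, ‖f k‖ ≤ √T := fun k => by
    refine le_sqrt_of_sq_le ?_
    have h1 : (‖f k‖ : ℝ) ^ 2 = ∫ x, ‖g k x‖ ^ 2 ∂ν := by
      rw [← inner_self_eq_norm_sq (𝕜 := ℂ), L2.inner_def, ← integral_re (L2.integrable_inner _ _)]
      refine integral_congr_ae ?_
      filter_upwards [(hg k).coeFn_toLp] with x hx
      rw [hx, inner_self_eq_norm_sq]
    rw [h1]; exact hT k
  have hinner : ∀ {a b : ℝ → ℂ} (ha : MemLp a 2 ν) (hb : MemLp b 2 ν),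
      inner ℂ (ha.toLp a) (hb.toLp b) = ∫ x, inner ℂ (a x) (b x) ∂ν := fun ha hb => by
    rw [L2.inner_def]
    refine integral_congr_ae ?_
    filter_upwards [ha.coeFn_toLp, hb.coeFn_toLp] with x h1 h2
    rw [h1, h2]
  have : Fact ((2 : ENNReal) ≠ ⊤) := ⟨by norm_num⟩
  -- Sequential Banach–Alaoglu in the dual of a separable `L²`, carried back to functions by the
  -- Riesz isomorphism.
  have hseq := WeakDual.isSeqCompact_closedBall ℂ X (0 : StrongDual ℂ X) (√T)
  obtain ⟨ℓ, -, φ, hφ, hlim⟩ := hseq (x := fun k =>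
    StrongDual.toWeakDual (InnerProductSpace.toDual ℂ X (f k))) fun k => by
      simpa using hnorm k
  set y : X := (InnerProductSpace.toDual ℂ X).symm (WeakDual.toStrongDual ℓ) with hy
  refine ⟨φ, hφ, y, Lp.memLp y, fun ψ hψ => ?_⟩
  have h := ((WeakDual.eval_continuous (hψ.toLp ψ)).tendsto ℓ).comp hlim
  have e1 : ℓ (hψ.toLp ψ) = ∫ x, inner ℂ (y x) (ψ x) ∂ν := by
    rw [← hinner (Lp.memLp y) hψ, Lp.toLp_coeFn, hy, InnerProductSpace.toDual_symm_apply]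
    rfl
  rw [← e1]
  refine h.congr fun k => ?_
  rw [← hinner (hg (φ k)) hψ]
  rfl

variable {V E H : Type*} {G : MetricGraph V E H} [Fintype V] [Fintype E] [Fintype H]

/-- A bounded sequence in `H¹` has a subsequence that converges pointwise, with weakly convergent
derivatives, to an element of `H¹`. -/
lemma exists_H1_limit (v : ℕ → G.H1) {m T B : ℝ} (hm : ∀ k, mass (v k) ≤ m)
    (hT : ∀ k, kinetic (v k) ≤ T)
    (hB : ∀ k e, ∀ x ∈ G.interval e, ‖(v k).toFun e x‖ ≤ B) :
    ∃ (u : G.H1) (φ : ℕ → ℕ), StrictMono φ ∧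
      (∀ e, ∀ x ∈ G.interval e, Tendsto (fun k => (v (φ k)).toFun e x) atTop (𝓝 (u.toFun e x))) ∧
      ∀ e ψ, MemLp ψ 2 (volume.restrict (G.interval e)) →
        Tendsto (fun k => ∫ x in G.interval e, inner ℂ ((v (φ k)).der e x) (ψ x)) atTop
          (𝓝 (∫ x in G.interval e, inner ℂ (u.der e x) (ψ x))) := by
  classical
  choose c hc using fun k => (v k).continuous_vertex
  -- vertices without edges carry no information
  set d : ℕ → V → ℂ := fun k x => if ‖c k x‖ ≤ B then c k x else 0 with hd
  have hend : ∀ e, G.len e ∈ G.interval (Sum.inl e : E ⊕ H) := fun e =>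
    ⟨(G.len_pos e).le, le_rfl⟩
  have hsrc : ∀ k e, d k (G.src e) = (v k).toFun (Sum.inl e) 0 := fun k e => by
    have h := hB k _ _ (zero_mem_interval (Sum.inl e))
    rw [((hc k).1 e).1] at h
    rw [hd, ((hc k).1 e).1]; exact if_pos h
  have htgt : ∀ k e, d k (G.tgt e) = (v k).toFun (Sum.inl e) (G.len e) := fun k e => by
    have h := hB k _ _ (hend e)
    rw [((hc k).1 e).2] at h
    rw [hd, ((hc k).1 e).2]; exact if_pos h
  have hroot : ∀ k h, d k (G.root h) = (v k).toFun (Sum.inr h) 0 := fun k h => by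
    have h' := hB k _ _ (zero_mem_interval (Sum.inr h))
    rw [(hc k).2 h] at h'
    rw [hd, (hc k).2 h]; exact if_pos h'
  have hdb : ∀ k, d k ∈ Metric.closedBall (0 : V → ℂ) |B| := fun k => by
    rw [mem_closedBall_zero_iff, pi_norm_le_iff_of_nonneg (abs_nonneg B)]
    intro x
    simp only [hd]
    split_ifs with h
    · exact h.trans (le_abs_self B)
    · simp
  -- Vertex values stay in a bounded set of a finite-dimensional space; their limits supply the
  -- integration constants and the continuity of the limit at the vertices.
  obtain ⟨a, -, φ₀, hφ₀, ha⟩ := tendsto_subseq_of_bounded Metric.isBounded_closedBall hdb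
  rw [tendsto_pi_nhds] at ha
  obtain ⟨ψ₀, hψ₀, hweak⟩ := exists_strictMono_forall (ι := E ⊕ H)
    (Q := fun e φ => ∃ g : ℝ → ℂ, MemLp g 2 (volume.restrict (G.interval e)) ∧
      ∀ ψ, MemLp ψ 2 (volume.restrict (G.interval e)) →
        Tendsto (fun k => ∫ x in G.interval e, inner ℂ ((v (φ k)).der e x) (ψ x)) atTop
          (𝓝 (∫ x in G.interval e, inner ℂ (g x) (ψ x))))
    (fun e φ => exists_weak_limit (fun k => (v (φ k)).memLp_der e)
      fun k => (integral_der_sq_le_kinetic (v (φ k)) e).trans (hT _))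
    (fun e φ ψ hψ ⟨g, hg, hlim⟩ => ⟨g, hg, fun χ hχ => (hlim χ hχ).comp hψ.tendsto_atTop⟩) φ₀
  choose g hgm hg using hweak
  set φ := φ₀ ∘ ψ₀ with hφ
  have ha' : ∀ x, Tendsto (fun k => d (φ k) x) atTop (𝓝 (a x)) := fun x =>
    (ha x).comp hψ₀.tendsto_atTop
  set b : E ⊕ H → V := Sum.elim G.src G.root with hb
  have hstart : ∀ e, Tendsto (fun k => (v (φ k)).toFun e 0) atTop (𝓝 (a (b e))) := by
    rintro (e | h)
    · exact (ha' (G.src e)).congr fun k => hsrc _ e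
    · exact (ha' (G.root h)).congr fun k => hroot _ h
  set U : E ⊕ H → ℝ → ℂ := fun e x => a (b e) + ∫ t in (0 : ℝ)..x, g e t with hU
  have hconv : ∀ e, ∀ x ∈ G.interval e,
      Tendsto (fun k => (v (φ k)).toFun e x) atTop (𝓝 (U e x)) := fun e x hx => by
    have hx0 := interval_nonneg hx
    have hsub : Ioc 0 x ⊆ G.interval e := Ioc_subset_Icc_self.trans (Icc_subset_interval le_rfl hx)
    -- Testing weak convergence against the indicator of `(0, x]` gives convergence of the
    -- primitives at `x`. The conjugate below comes from the inner product being antilinear in its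
    -- first slot.
    have hψ : MemLp ((Ioc 0 x).indicator fun _ => (1 : ℂ)) 2 (volume.restrict (G.interval e)) :=
      (memLp_indicator_const 2 measurableSet_Ioc 1 (Or.inr (by
        refine ne_top_of_le_ne_top ?_ (Measure.restrict_apply_le _ _)
        simp)))
    have hrepr : ∀ f : ℝ → ℂ,
        ∫ t in G.interval e, inner ℂ (f t) ((Ioc 0 x).indicator (fun _ => (1 : ℂ)) t)
        = conj (∫ t in (0 : ℝ)..x, f t) := fun f => by
      have e1 : ∀ t, inner ℂ (f t) ((Ioc 0 x).indicator (fun _ => (1 : ℂ)) t)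
          = (Ioc 0 x).indicator (fun t => conj (f t)) t := fun t => by
        by_cases ht : t ∈ Ioc 0 x <;> simp [ht]
      simp_rw [e1]
      rw [setIntegral_indicator measurableSet_Ioc, inter_eq_self_of_subset_right hsub,
        intervalIntegral.integral_of_le hx0, integral_conj]
    have h := hg e _ hψ
    simp_rw [hrepr] at h
    have h' := (Complex.continuous_conj.tendsto _).comp h
    simp only [Function.comp_def, Complex.conj_conj] at h'
    exact ((hstart e).add h').congr fun k => ((v (φ k)).eq_add_integral e x hx).symm
  have hU0 : ∀ e, U e 0 = a (b e) := fun e => by simp [hU]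
  have hUm : ∀ e, MemLp (U e) 2 (volume.restrict (G.interval e)) := fun e => by
    have hae : ∀ᵐ x ∂(volume.restrict (G.interval e)),
        Tendsto (fun k => (v (φ k)).toFun e x) atTop (𝓝 (U e x)) := by
      filter_upwards [ae_restrict_mem (measurableSet_interval e)] with x hx
      exact hconv e x hx
    refine ⟨aestronglyMeasurable_of_tendsto_ae atTop
      (fun k => (v (φ k)).aestronglyMeasurable e) hae, ?_⟩
    -- Fatou's lemma: square integrability of the limit follows from the uniform mass bound.
    refine (Lp.eLpNorm_lim_le_liminf_eLpNorm
      (fun k => (v (φ k)).aestronglyMeasurable e) (U e) hae).trans_lt ?_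
    have hbd : ∀ k, eLpNorm ((v (φ k)).toFun e) 2 (volume.restrict (G.interval e))
        ≤ ENNReal.ofReal (m ^ ((2 : ℝ)⁻¹)) := fun k => by
      rw [((v (φ k)).memLp_toFun e).eLpNorm_eq_integral_rpow_norm (by norm_num) (by norm_num)]
      refine ENNReal.ofReal_le_ofReal ?_
      simp only [ENNReal.toReal_ofNat, rpow_two]
      exact rpow_le_rpow (integral_nonneg fun _ => sq_nonneg _)
        ((integral_sq_le_mass _ e).trans (hm _)) (by norm_num)
    exact (liminf_le_of_le (by isBoundedDefault) fun c hc => by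
      obtain ⟨k, hk⟩ := hc.exists
      exact hk.trans (hbd k)).trans_lt ENNReal.ofReal_lt_top
  refine ⟨⟨U, g, hUm, hgm, fun e x _ => by rw [hU0], ⟨a, fun e => ⟨hU0 _, ?_⟩, fun h => hU0 _⟩⟩,
    φ, hφ₀.comp hψ₀, hconv, hg⟩
  -- At the far end of an edge, the primitive and the limiting vertex value are limits of the same
  -- sequence.
  exact tendsto_nhds_unique (hconv _ _ (hend e)) ((ha' (G.tgt e)).congr fun k => htgt _ e)

end MetricGraph

namespace MetricGraph

open Real Set Filter Topology ComplexConjugate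

variable {V E H : Type*} {G : MetricGraph V E H}

/-! ### Scalar multiples -/

/-- Multiplication of an element of `H¹` by a real number. -/
def H1.scale (c : ℝ) (u : G.H1) : G.H1 where
  toFun e x := c * u.toFun e x
  der e x := c * u.der e x
  memLp_toFun e := (u.memLp_toFun e).const_mul _
  memLp_der e := (u.memLp_der e).const_mul _
  eq_add_integral e x hx := by
    rw [u.eq_add_integral e x hx, intervalIntegral.integral_const_mul, mul_add]
  continuous_vertex := by
    obtain ⟨a, h1, h2⟩ := u.continuous_vertex
    exact ⟨fun x => c * a x, fun e => ⟨by rw [(h1 e).1], by rw [(h1 e).2]⟩, fun h => by rw [h2 h]⟩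

/-! ### Cutting the half-lines -/

variable (G) in
/-- The part of an edge that remains when all half-lines are cut at distance `R`. -/
def trunc (R : ℝ) : E ⊕ H → Set ℝ
  | Sum.inl e => Icc 0 (G.len e)
  | Sum.inr _ => Icc 0 R

lemma trunc_subset (R : ℝ) (e : E ⊕ H) : G.trunc R e ⊆ G.interval e := by
  rcases e with e | h
  exacts [Subset.rfl, Icc_subset_Ici_self]

lemma measurableSet_trunc (R : ℝ) (e : E ⊕ H) : MeasurableSet (G.trunc R e) := by
  rcases e with e | h
  exacts [measurableSet_Icc, measurableSet_Icc]

lemma volume_trunc_ne_top (R : ℝ) (e : E ⊕ H) : volume (G.trunc R e) ≠ ⊤ := by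
  rcases e with e | h <;> simp [trunc]

lemma tendsto_integral_trunc {e : E ⊕ H} {f : ℝ → ℝ} (hf : IntegrableOn f (G.interval e)) :
    Tendsto (fun R => ∫ x in G.trunc R e, f x) atTop (𝓝 (∫ x in G.interval e, f x)) := by
  rcases e with e | h
  · exact tendsto_const_nhds
  · have h := intervalIntegral_tendsto_integral_Ioi 0 (hf.mono_set Ioi_subset_Ici_self) tendsto_id
    simp only [trunc, interval, integral_Ici_eq_integral_Ioi]
    refine h.congr' ?_
    filter_upwards [eventually_ge_atTop 0] with R hR
    rw [id, intervalIntegral.integral_of_le hR, integral_Icc_eq_integral_Ioc]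

/-- Truncated edges have finite measure and the sequence is uniformly bounded, so dominated
convergence applies; only the tails of half-lines escape it. -/
lemma tendsto_integral_trunc_comp {v : ℕ → G.H1} {u : G.H1} {e : E ⊕ H} {B : ℝ}
    (hB : ∀ k, ∀ x ∈ G.interval e, ‖(v k).toFun e x‖ ≤ B)
    (hv : ∀ x ∈ G.interval e, Tendsto (fun k => (v k).toFun e x) atTop (𝓝 (u.toFun e x)))
    {F : ℂ → ℝ} (hF : Continuous F) (R : ℝ) :
    Tendsto (fun k => ∫ x in G.trunc R e, F ((v k).toFun e x)) atTop
      (𝓝 (∫ x in G.trunc R e, F (u.toFun e x))) := by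
  obtain ⟨C, hC⟩ := (isCompact_closedBall (0 : ℂ) B).exists_bound_of_continuousOn hF.continuousOn
  refine tendsto_integral_of_dominated_convergence (fun _ => C)
    (fun k => hF.comp_aestronglyMeasurable (((v k).aestronglyMeasurable e).mono_measure
      (Measure.restrict_mono (trunc_subset R e) le_rfl)))
    (integrableOn_const (volume_trunc_ne_top R e)) (fun k => ?_) ?_
  · filter_upwards [ae_restrict_mem (measurableSet_trunc R e)] with x hx
    exact hC _ (mem_closedBall_zero_iff.2 (hB k x (trunc_subset R e hx)))
  · filter_upwards [ae_restrict_mem (measurableSet_trunc R e)] with x hx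
    exact (hF.tendsto _).comp (hv x (trunc_subset R e hx))

lemma tendsto_cycleEnergy [Fintype V] [Fintype E] (A : E ⊕ H → ℝ → ℝ) (C : G.IndependentCycles)
    {v : ℕ → G.H1} {u : G.H1}
    {B : ℝ} (hB : ∀ k e, ∀ x ∈ G.interval e, ‖(v k).toFun e x‖ ≤ B)
    (hv : ∀ e, ∀ x ∈ G.interval e, Tendsto (fun k => (v k).toFun e x) atTop (𝓝 (u.toFun e x))) :
    Tendsto (fun k => cycleEnergy A C (v k)) atTop (𝓝 (cycleEnergy A C u)) := by
  refine tendsto_finsetSum _ fun i _ => tendsto_list_sum _ fun s _ => ?_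
  exact tendsto_integral_trunc_comp (e := Sum.inl s.1)
    (F := fun z => (C.cycle i).potential A * ‖z‖ ^ 2)
    -- The radius `0` is arbitrary: truncation does not affect a bounded edge.
    (fun k => hB k _) (hv _) (continuous_const.mul (continuous_norm.pow 2)) 0

/-- It linearizes the kinetic energy: a lower bound affine in the derivative of `u` passes to weak
limits. When `w` is the limit itself, nothing is lost, which gives weak lower semicontinuity. -/
lemma re_integral_inner_le (u w : G.H1) (e : E ⊕ H) (R : ℝ) :
    (∫ x in G.interval e, inner ℂ (u.der e x) ((G.trunc R e).indicator (w.der e) x)).re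
      ≤ 1 / 2 * (∫ x in G.trunc R e, ‖u.der e x‖ ^ 2)
        + 1 / 2 * ∫ x in G.trunc R e, ‖w.der e x‖ ^ 2 := by
  have e1 : ∀ x, inner ℂ (u.der e x) ((G.trunc R e).indicator (w.der e) x)
      = (G.trunc R e).indicator (fun x => inner ℂ (u.der e x) (w.der e x)) x := fun x => by
    by_cases hx : x ∈ G.trunc R e <;> simp [hx]
  have hu := (u.integrableOn_der_sq e).mono_set (trunc_subset R e)
  have hw := (w.integrableOn_der_sq e).mono_set (trunc_subset R e)
  simp_rw [e1]
  rw [setIntegral_indicator (measurableSet_trunc R e),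
    inter_eq_self_of_subset_right (trunc_subset R e), ← integral_const_mul, ← integral_const_mul,
    ← integral_add (hu.const_mul _) (hw.const_mul _)]
  refine (Complex.re_le_norm _).trans (norm_integral_le_of_norm_le
    ((hu.const_mul _).add (hw.const_mul _)) (Eventually.of_forall fun x => ?_))
  refine (norm_inner_le_norm _ _).trans ?_
  nlinarith [sq_nonneg (‖u.der e x‖ - ‖w.der e x‖)]

lemma re_integral_inner_self (w : G.H1) (e : E ⊕ H) (R : ℝ) :
    (∫ x in G.interval e, inner ℂ (w.der e x) ((G.trunc R e).indicator (w.der e) x)).re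
      = ∫ x in G.trunc R e, ‖w.der e x‖ ^ 2 := by
  have e1 : ∀ x, inner ℂ (w.der e x) ((G.trunc R e).indicator (w.der e) x)
      = (((G.trunc R e).indicator (fun x => ‖w.der e x‖ ^ 2) x : ℝ) : ℂ) := fun x => by
    by_cases hx : x ∈ G.trunc R e
    · simp only [hx, indicator_of_mem]
      rw [inner_self_eq_norm_sq_to_K]; norm_cast
    · simp [hx]
  simp_rw [e1]
  rw [integral_complex_ofReal, Complex.ofReal_re, setIntegral_indicator (measurableSet_trunc R e),
    inter_eq_self_of_subset_right (trunc_subset R e)]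

variable [Fintype E] [Fintype H]

lemma mass_scale (c : ℝ) (u : G.H1) : mass (u.scale c) = c ^ 2 * mass u := by
  simp [mass, H1.scale, mul_pow, integral_const_mul, Finset.mul_sum, -Fintype.sum_sum_type]

lemma sum_integral_eq_trunc_add {f : E ⊕ H → ℝ → ℝ} (hf : ∀ e, IntegrableOn (f e) (G.interval e))
    {R : ℝ} (hR : 0 ≤ R) :
    ∑ e, ∫ x in G.interval e, f e x
      = (∑ e, ∫ x in G.trunc R e, f e x) + ∑ h, ∫ x in Ioi R, f (Sum.inr h) x := by
  rw [Fintype.sum_sum_type, Fintype.sum_sum_type, add_assoc, ← Finset.sum_add_distrib]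
  congr 1
  refine Finset.sum_congr rfl fun h _ => ?_
  have e1 : G.interval (Sum.inr h : E ⊕ H) = Icc 0 R ∪ Ioi R := (Icc_union_Ioi_eq_Ici hR).symm
  have hi := hf (Sum.inr h)
  rw [e1] at hi ⊢
  exact setIntegral_union (disjoint_left.2 fun x hx hx' => not_lt_of_ge hx.2 hx')
    measurableSet_Ioi (hi.mono_set subset_union_left) (hi.mono_set subset_union_right)

/-- The energy beyond the cut, bounded below by the energy of the soliton. -/
lemma neg_binding_sub_le_tail {p : ℝ} (hp2 : 2 < p) (hp6 : p < 6) (u : G.H1) {B : ℝ}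
    (hB : ∀ e, ∀ x ∈ G.interval e, ‖u.toFun e x‖ ≤ B) {R : ℝ} (hR : 0 ≤ R) :
    -Soliton.binding p (mass u - ∑ e, ∫ x in G.trunc R e, ‖u.toFun e x‖ ^ 2)
        - √(2 / p) / 2 * B ^ (p / 2 - 1) * ∑ h, ‖u.toFun (Sum.inr h) R‖ ^ 2
      ≤ 1 / 2 * (∑ h, ∫ x in Ioi R, ‖u.der (Sum.inr h) x‖ ^ 2)
        - 1 / p * ∑ h, ∫ x in Ioi R, ‖u.toFun (Sum.inr h) x‖ ^ p := by
  have hsub : Ioi R ⊆ Ici 0 := Ioi_subset_Ici_self.trans (Ici_subset_Ici.2 hR)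
  have h := fun h : H => neg_binding_sub_le_halfLine (p := p) (R := R) (B := B)
    (n := fun x => ‖u.toFun (Sum.inr h) x‖) (g := fun x => ‖u.der (Sum.inr h) x‖) hp2 hp6
    (fun _ _ => norm_nonneg _) (fun x hx => hB (Sum.inr h) x (hR.trans hx))
    ((u.integrableOn_sq (Sum.inr h)).mono_set hsub) (fun _ => norm_nonneg _)
    ((u.memLp_der (Sum.inr h)).1.mono_measure (Measure.restrict_mono hsub le_rfl)).norm
    ((u.integrableOn_der_sq (Sum.inr h)).mono_set hsub)
    (fun x y hx hxy => (u.intervalIntegrable_der (e := Sum.inr h) (hR.trans hx) hxy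
      (hR.trans (hx.trans hxy) : (0 : ℝ) ≤ y)).norm)
    (fun x y hx hxy => u.abs_norm_sub_le_integral (e := Sum.inr h) (hR.trans hx) hxy
      (hR.trans (hx.trans hxy) : (0 : ℝ) ≤ y))
  have hsum := Finset.sum_le_sum fun i (_ : i ∈ Finset.univ) => h i
  simp only [Finset.sum_sub_distrib, ← Finset.mul_sum, Finset.sum_neg_distrib] at hsum
  -- Masses escaping along different half-lines are merged into one soliton, which has the lowest
  -- energy.
  have hsuper := Soliton.sum_binding_le Finset.univ hp2 hp6
    (m := fun h : H => ∫ x in Ioi R, ‖u.toFun (Sum.inr h) x‖ ^ 2)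
    fun h => integral_nonneg fun x => sq_nonneg _
  have hmass := sum_integral_eq_trunc_add (fun e => u.integrableOn_sq e) hR
  have e2 : mass u - ∑ e, ∫ x in G.trunc R e, ‖u.toFun e x‖ ^ 2
      = ∑ h, ∫ x in Ioi R, ‖u.toFun (Sum.inr h) x‖ ^ 2 := by
    rw [mass, hmass]; ring
  rw [e2]
  linarith

/-! ### The limiting energy when mass escapes along the half-lines -/

variable [Fintype V]

/-- Lower bound for the energy, in a form that passes to weak limits. -/
lemma le_effectiveEnergy {p : ℝ} (hp2 : 2 < p) (hp6 : p < 6) (A : E ⊕ H → ℝ → ℝ)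
    (C : G.IndependentCycles) (u w : G.H1) {B : ℝ}
    (hB : ∀ e, ∀ x ∈ G.interval e, ‖u.toFun e x‖ ≤ B) {R : ℝ} (hR : 0 ≤ R) :
    (∑ e, (∫ x in G.interval e,
          inner ℂ (u.der e x) ((G.trunc R e).indicator (w.der e) x)).re)
        - 1 / 2 * (∑ e, ∫ x in G.trunc R e, ‖w.der e x‖ ^ 2)
        - 1 / p * (∑ e, ∫ x in G.trunc R e, ‖u.toFun e x‖ ^ p) + cycleEnergy A C u
        - Soliton.binding p (mass u - ∑ e, ∫ x in G.trunc R e, ‖u.toFun e x‖ ^ 2)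
        - √(2 / p) / 2 * B ^ (p / 2 - 1) * ∑ h, ‖u.toFun (Sum.inr h) R‖ ^ 2
      ≤ effectiveEnergy p A C u := by
  have h1 := neg_binding_sub_le_tail hp2 hp6 u hB hR
  have h2 := Finset.sum_le_sum fun e (_ : e ∈ Finset.univ) => re_integral_inner_le u w e R
  rw [Finset.sum_add_distrib, ← Finset.mul_sum, ← Finset.mul_sum] at h2
  have h3 := sum_integral_eq_trunc_add (fun e => u.integrableOn_der_sq e) hR
  have h4 := sum_integral_eq_trunc_add
    (fun e => (u.integrableOn_rpow hp2.le (hB e)).1) hR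
  rw [effectiveEnergy_eq, kinetic, h3, h4]
  linarith

/-- The energy of a weak limit, plus that of a soliton carrying the lost mass, is at most the
limit of the energies. -/
lemma effectiveEnergy_sub_binding_le {p : ℝ} (hp2 : 2 < p) (hp6 : p < 6) (A : E ⊕ H → ℝ → ℝ)
    (C : G.IndependentCycles) {v : ℕ → G.H1} {u : G.H1} {B μ J : ℝ}
    (hm : ∀ k, mass (v k) = μ)
    (hB : ∀ k e, ∀ x ∈ G.interval e, ‖(v k).toFun e x‖ ≤ B)
    (hv : ∀ e, ∀ x ∈ G.interval e, Tendsto (fun k => (v k).toFun e x) atTop (𝓝 (u.toFun e x)))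
    (hd : ∀ e ψ, MemLp ψ 2 (volume.restrict (G.interval e)) →
        Tendsto (fun k => ∫ x in G.interval e, inner ℂ ((v k).der e x) (ψ x)) atTop
          (𝓝 (∫ x in G.interval e, inner ℂ (u.der e x) (ψ x))))
    (hJ : Tendsto (fun k => effectiveEnergy p A C (v k)) atTop (𝓝 J)) :
    mass u ≤ μ ∧ effectiveEnergy p A C u - Soliton.binding p (μ - mass u) ≤ J := by
  have hbind := Soliton.continuous_binding hp2 hp6
  obtain ⟨b, hb⟩ := exists_norm_le u
  have hpow : Continuous fun z : ℂ => ‖z‖ ^ p :=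
    (continuous_rpow_const (by linarith)).comp continuous_norm
  have hmR : ∀ R, Tendsto (fun k => ∑ e, ∫ x in G.trunc R e, ‖(v k).toFun e x‖ ^ 2) atTop
      (𝓝 (∑ e, ∫ x in G.trunc R e, ‖u.toFun e x‖ ^ 2)) := fun R =>
    tendsto_finsetSum _ fun e _ => tendsto_integral_trunc_comp (F := fun z => ‖z‖ ^ 2)
      (fun k => hB k e) (hv e) (continuous_norm.pow 2) R
  have hmass : Tendsto (fun R => ∑ e, ∫ x in G.trunc R e, ‖u.toFun e x‖ ^ 2) atTop (𝓝 (mass u)) :=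
    tendsto_finsetSum _ fun e _ => tendsto_integral_trunc (u.integrableOn_sq e)
  refine ⟨le_of_tendsto' hmass fun R => le_of_tendsto' (hmR R) fun k => ?_, ?_⟩
  · rw [← hm k]
    exact Finset.sum_le_sum fun e _ => setIntegral_mono_set ((v k).integrableOn_sq e)
      (Eventually.of_forall fun x => sq_nonneg _) (trunc_subset R e).eventuallyLE
  set c := √(2 / p) / 2 * B ^ (p / 2 - 1) with hc
  -- The sequence goes to its limit at a fixed cut `R`, and only then `R → ∞`. The boundary term
  -- then involves `u` alone.
  have hcut : ∀ R, 0 ≤ R → 1 / 2 * (∑ e, ∫ x in G.trunc R e, ‖u.der e x‖ ^ 2)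
        - 1 / p * (∑ e, ∫ x in G.trunc R e, ‖u.toFun e x‖ ^ p) + cycleEnergy A C u
        - Soliton.binding p (μ - ∑ e, ∫ x in G.trunc R e, ‖u.toFun e x‖ ^ 2)
        - c * ∑ h, ‖u.toFun (Sum.inr h) R‖ ^ 2 ≤ J := fun R hR => by
    have t1 : Tendsto (fun k => ∑ e, (∫ x in G.interval e,
        inner ℂ ((v k).der e x) ((G.trunc R e).indicator (u.der e) x)).re) atTop
        (𝓝 (∑ e, ∫ x in G.trunc R e, ‖u.der e x‖ ^ 2)) := by
      refine tendsto_finsetSum _ fun e _ => ?_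
      rw [← re_integral_inner_self]
      exact (Complex.continuous_re.tendsto _).comp
        (hd e _ ((u.memLp_der e).indicator (measurableSet_trunc R e)))
    have t2 : Tendsto (fun k => ∑ e, ∫ x in G.trunc R e, ‖(v k).toFun e x‖ ^ p) atTop
        (𝓝 (∑ e, ∫ x in G.trunc R e, ‖u.toFun e x‖ ^ p)) :=
      tendsto_finsetSum _ fun e _ => tendsto_integral_trunc_comp (F := fun z => ‖z‖ ^ p)
        (fun k => hB k e) (hv e) hpow R
    have t3 := tendsto_cycleEnergy A C hB hv
    have t4 := (hbind.tendsto _).comp ((hmR R).const_sub μ)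
    have t5 : Tendsto (fun k => ∑ h, ‖(v k).toFun (Sum.inr h) R‖ ^ 2) atTop
        (𝓝 (∑ h, ‖u.toFun (Sum.inr h) R‖ ^ 2)) :=
      tendsto_finsetSum _ fun h _ => ((hv (Sum.inr h) R hR).norm.pow 2)
    have t := ((((t1.sub_const (1 / 2 * (∑ e, ∫ x in G.trunc R e, ‖u.der e x‖ ^ 2))).sub
      (t2.const_mul (1 / p))).add t3).sub t4).sub (t5.const_mul c)
    have h := le_of_tendsto_of_tendsto' t hJ fun k => by
      have h := le_effectiveEnergy hp2 hp6 A C (v k) u (hB k) hR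
      rw [hm k] at h
      exact h
    linarith
  have hlim : Tendsto (fun R => 1 / 2 * (∑ e, ∫ x in G.trunc R e, ‖u.der e x‖ ^ 2)
        - 1 / p * (∑ e, ∫ x in G.trunc R e, ‖u.toFun e x‖ ^ p) + cycleEnergy A C u
        - Soliton.binding p (μ - ∑ e, ∫ x in G.trunc R e, ‖u.toFun e x‖ ^ 2)) atTop
      (𝓝 (effectiveEnergy p A C u - Soliton.binding p (μ - mass u))) := by
    have t1 : Tendsto (fun R => ∑ e, ∫ x in G.trunc R e, ‖u.der e x‖ ^ 2) atTop
        (𝓝 (kinetic u)) :=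
      tendsto_finsetSum _ fun e _ => tendsto_integral_trunc (u.integrableOn_der_sq e)
    have t2 : Tendsto (fun R => ∑ e, ∫ x in G.trunc R e, ‖u.toFun e x‖ ^ p) atTop
        (𝓝 (∑ e, ∫ x in G.interval e, ‖u.toFun e x‖ ^ p)) :=
      tendsto_finsetSum _ fun e _ =>
        tendsto_integral_trunc (u.integrableOn_rpow hp2.le (hb e)).1
    exact (((t1.const_mul (1 / 2)).sub (t2.const_mul (1 / p))).add_const _).sub
      ((hbind.tendsto _).comp (hmass.const_sub μ))
  refine le_of_forall_pos_le_add fun ε hε => ?_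
  -- The boundary term is shown to be small only at arbitrarily large cuts, by integrability of
  -- `|u|²`; this is enough because the rest converges.
  refine le_of_tendsto_of_frequently hlim (frequently_atTop.2 fun S => ?_)
  have hint : IntegrableOn (fun x => ∑ h, ‖u.toFun (Sum.inr h) x‖ ^ 2) (Ioi 0) :=
    integrable_finsetSum _ fun h _ => (u.integrableOn_sq (Sum.inr h)).mono_set Ioi_subset_Ici_self
  obtain ⟨R, hRS, hR⟩ := exists_lt_of_integrableOn_Ioi hint (max S 0)
    (ε := ε / (|c| + 1)) (by positivity)
  refine ⟨R, (le_max_left _ _).trans hRS, ?_⟩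
  have h := hcut R ((le_max_right _ _).trans hRS)
  have h0 : 0 ≤ ∑ h, ‖u.toFun (Sum.inr h) R‖ ^ 2 := Finset.sum_nonneg fun _ _ => sq_nonneg _
  have h1 : c * ∑ h, ‖u.toFun (Sum.inr h) R‖ ^ 2 ≤ ε := by
    calc c * ∑ h, ‖u.toFun (Sum.inr h) R‖ ^ 2
        ≤ (|c| + 1) * (ε / (|c| + 1)) :=
          mul_le_mul (by linarith [le_abs_self c]) hR.le h0 (by positivity)
      _ = ε := by field_simp
  linarith

/-! ### Dependence on the mass -/

lemma effectiveEnergy_scale (p : ℝ) (A : E ⊕ H → ℝ → ℝ) (C : G.IndependentCycles) {c : ℝ}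
    (hc : 0 ≤ c) (u : G.H1) :
    effectiveEnergy p A C (u.scale c) = c ^ 2 * (1 / 2 * kinetic u + cycleEnergy A C u)
      - c ^ p * (1 / p * ∑ e, ∫ x in G.interval e, ‖u.toFun e x‖ ^ p) := by
  have h1 : kinetic (u.scale c) = c ^ 2 * kinetic u := by
    simp [kinetic, H1.scale, mul_pow, integral_const_mul, Finset.mul_sum, -Fintype.sum_sum_type]
  have h2 : cycleEnergy A C (u.scale c) = c ^ 2 * cycleEnergy A C u := by
    simp only [cycleEnergy, H1.scale, Finset.mul_sum, ← List.sum_map_mul_left,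
      ← integral_const_mul]
    simp only [norm_mul, mul_pow, Complex.norm_real, norm_eq_abs, sq_abs, mul_left_comm]
  have h3 : ∑ e, ∫ x in G.interval e, ‖(u.scale c).toFun e x‖ ^ p
      = c ^ p * ∑ e, ∫ x in G.interval e, ‖u.toFun e x‖ ^ p := by
    simp [H1.scale, abs_of_nonneg hc, mul_rpow hc, integral_const_mul, Finset.mul_sum,
      -Fintype.sum_sum_type]
  rw [effectiveEnergy_eq, h1, h2, h3]
  ring

/-- The infimum of the energy grows at least linearly in the mass. -/
lemma mul_le_effectiveEnergy {p : ℝ} (hp2 : 2 < p) (A : E ⊕ H → ℝ → ℝ) (C : G.IndependentCycles)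
    {μ J : ℝ} (hμ : 0 < μ) (hJ : ∀ w : G.H1, mass w = μ → J ≤ effectiveEnergy p A C w)
    (u : G.H1) (hu : mass u ≤ μ) : mass u / μ * J ≤ effectiveEnergy p A C u := by
  have hQ := cycleEnergy_nonneg A C u
  have hD := kinetic_nonneg u
  have hp0 : 0 < p := by linarith
  have hP : 0 ≤ 1 / p * ∑ e, ∫ x in G.interval e, ‖u.toFun e x‖ ^ p :=
    mul_nonneg (by positivity) (Finset.sum_nonneg fun _ _ => integral_nonneg fun _ =>
      rpow_nonneg (norm_nonneg _) _)
  rcases (mass_nonneg u).eq_or_lt with h0 | h0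
  · obtain ⟨b, hb⟩ := exists_norm_le u
    have hz : ∑ e, ∫ x in G.interval e, ‖u.toFun e x‖ ^ p ≤ b ^ (p - 2) * mass u := by
      rw [mass, Finset.mul_sum]
      exact Finset.sum_le_sum fun e _ => (u.integrableOn_rpow hp2.le (hb e)).2
    rw [← h0, mul_zero] at hz
    have := mul_nonpos_of_nonneg_of_nonpos (show 0 ≤ 1 / p by positivity) hz
    rw [← h0, effectiveEnergy_eq, zero_div, zero_mul]
    linarith
  -- Scaling up to mass `μ` uses `c ≥ 1`: the focusing term grows by `c^p ≥ c²`, so the energy is at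
  -- most multiplied by `c² = μ / mass u`.
  · set c := √(μ / mass u) with hc
    have hc2 : c ^ 2 = μ / mass u := sq_sqrt (by positivity)
    have hc1 : 1 ≤ c := one_le_sqrt.2 ((one_le_div h0).2 hu)
    have h := hJ (u.scale c) (by rw [mass_scale, hc2]; field_simp)
    rw [effectiveEnergy_scale p A C (by linarith)] at h
    have hcp : c ^ 2 ≤ c ^ p := by
      rw [← rpow_two]; exact rpow_le_rpow_of_exponent_le hc1 hp2.le
    have h1 : J ≤ c ^ 2 * effectiveEnergy p A C u := by
      rw [effectiveEnergy_eq]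
      nlinarith [mul_le_mul_of_nonneg_right hcp hP]
    rw [hc2] at h1
    calc mass u / μ * J ≤ mass u / μ * (μ / mass u * effectiveEnergy p A C u) :=
          mul_le_mul_of_nonneg_left h1 (by positivity)
      _ = effectiveEnergy p A C u := by field_simp

end MetricGraph

end

/-! ### Existence of the ground state -/

theorem mainTheorem1 {V E H : Type*} [Fintype V] [Fintype E] [Fintype H] [Nonempty H]
    (G : MetricGraph V E H) (hG : G.Connected)
    (A : E ⊕ H → ℝ → ℝ) (hA : G.IsL2Loc A) (C : G.IndependentCycles)
    (p : ℝ) (hp2 : 2 < p) (hp6 : p < 6) (μ : ℝ) (hμ : 0 < μ)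
    (hv : ∃ v : G.H1, MetricGraph.mass v = μ ∧
      MetricGraph.effectiveEnergy p A C v < Soliton.lineEnergy p (Soliton.soliton p μ)) :
    ∃ u : G.H1, MetricGraph.IsGroundState p A C μ u := by
  obtain ⟨v₀, hv₀, hlt⟩ := hv
  rw [Soliton.lineEnergy_soliton hp2 hp6 hμ] at hlt
  obtain ⟨K, hK⟩ := MetricGraph.exists_kinetic_le hp2 hp6 μ hμ.le A C
  set S : Set ℝ := MetricGraph.effectiveEnergy p A C '' {w : G.H1 | MetricGraph.mass w = μ} with hS
  have hne : S.Nonempty := ⟨_, v₀, hv₀, rfl⟩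
  have hbdd : BddBelow S := ⟨-K, by
    rintro _ ⟨w, hw, rfl⟩
    linarith [hK w hw, MetricGraph.kinetic_nonneg w]⟩
  set J := sInf S with hJ
  have hJle : ∀ w : G.H1, MetricGraph.mass w = μ → J ≤ MetricGraph.effectiveEnergy p A C w :=
    fun w hw => csInf_le hbdd ⟨w, hw, rfl⟩
  obtain ⟨s, hsanti, hslim, hsmem⟩ := exists_seq_tendsto_sInf hne hbdd
  choose v hvm hvs using hsmem
  have hT : ∀ k, MetricGraph.kinetic (v k) ≤ 4 * (s 0 + K) := fun k => by
    have h1 := hK (v k) (hvm k)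
    rw [hvs k] at h1
    linarith [hsanti (Nat.zero_le k)]
  obtain ⟨c, hc, hcb⟩ := MetricGraph.exists_norm_sq_le G μ hμ.le
  have hB : ∀ k e, ∀ x ∈ G.interval e,
      ‖(v k).toFun e x‖ ≤ √(c * √(1 + 4 * (s 0 + K))) := fun k e x hx =>
    Real.le_sqrt_of_sq_le ((hcb (v k) (hvm k).le e x hx).trans
      (mul_le_mul_of_nonneg_left (Real.sqrt_le_sqrt (by linarith [hT k])) hc.le))
  obtain ⟨u, φ, hφ, hlim, hder⟩ :=
    MetricGraph.exists_H1_limit v (fun k => (hvm k).le) hT hB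
  obtain ⟨hmu, hE⟩ := MetricGraph.effectiveEnergy_sub_binding_le hp2 hp6 A C
    (fun k => hvm (φ k)) (fun k => hB (φ k)) hlim hder (J := J)
    ((hslim.comp hφ.tendsto_atTop).congr fun k => (hvs (φ k)).symm)
  have hscale := MetricGraph.mul_le_effectiveEnergy hp2 A C hμ hJle u hmu
  have hJlt : J < -Soliton.binding p μ := (hJle v₀ hv₀).trans_lt hlt
  have hb := Soliton.binding_le_of_le hp2 hp6 (sub_nonneg.2 hmu)
    (sub_le_self μ (MetricGraph.mass_nonneg u)) hμ
  -- Complete loss of mass (`mass u = 0`) and partial loss are excluded by the same strict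
  -- inequality.
  have hmass : MetricGraph.mass u = μ := by
    refine hmu.eq_of_not_lt fun hlt' => ?_
    have h1 : 0 < (μ - MetricGraph.mass u) / μ := div_pos (sub_pos.2 hlt') hμ
    have h2 : MetricGraph.mass u / μ = 1 - (μ - MetricGraph.mass u) / μ := by field_simp; ring
    rw [h2] at hscale
    nlinarith [mul_lt_mul_of_pos_left hJlt h1]
  refine ⟨u, hmass, fun w hw => le_trans ?_ (hJle w hw)⟩
  rwa [hmass, sub_self, Soliton.binding_zero hp2 hp6, sub_zero] at hE
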